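/- Let $p$ be a prime, $q$ a power of $p$, and $\mathbb F_q$ the field with $q$ elements. On $\mathbb F_q((T^{-1}))$ let $|0|=0$ and $|\sum_{n\ge N}a_nT^{-n}|=q^{-N}$ when $a_N\ne 0$; extend $|\cdot|$ (uniquely) to an algebraic closure of $\mathbb F_q((T^{-1}))$, which contains an algebraic closure $\overline{\mathbb F_q(T)}$ of $\mathbb F_q(T)$. The height $H(P)$ of $P\in(\mathbb F_q[T])[X]$ is the maximum of the absolute values of its coefficients. The minimal polynomial of $\alpha\in\overline{\mathbb F_q(T)}$ is the unique non-constant, irreducible, primitive $P\in(\mathbb F_q[T])[X]$ with leading coefficient monic in $T$ and $P(\alpha)=0$; the degree and the height $H(\alpha)$ of $\alpha$ are the degree in $X$ and the height of this $P$. For $\xi\in\mathbb F_q((T^{-1}))$ and an integer $n\ge 1$, let $w_n(\xi)\in[-\infty,+\infty]$ be the supremum of the real numbers $v$ such that $0<|P(\xi)|\le H(P)^{-v}$ for infinitely many $P\in(\mathbb F_q[T])[X]$ of degree at most $n$, and let $w_n^*(\xi)\in[-\infty,+\infty]$ be the supremum of the real numbers $v$ such that $0<|\xi-\alpha|\le H(\alpha)^{-v-1}$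 for infinitely many $\alpha\in\overline{\mathbb F_q(T)}$ of degree at most $n$. An element $\alpha\in\mathbb F_q((T^{-1}))\setminus\mathbb F_q(T)$ is of Class IA if there are an integer $s\ge 0$ and $R,S,V,U\in\mathbb F_q[T]$ with $RU-SV\in\mathbb F_q^\times$ such that $$\alpha=\frac{R\alpha^{p^s}+S}{V\alpha^{p^s}+U},$$ where, if $s=0$, the matrix $\begin{pmatrix}R&S\\V&U\end{pmatrix}$ is required not to be scalar (so that the relation is not the trivial one $\alpha=\alpha$). **Theorem.** Let $d\ge 1$ be an integer and let $w>2d-1$ be a rational number. Then there exist a strictly increasing sequence of positive integers $(k_j)_j$ and a sequence $(\xi_j)_j$ in $\mathbb F_q((T^{-1}))$ such that, for every $j$, $\xi_j$ is of Class IA, is algebraic over $\mathbb F_q(T)$ of degree $p^{k_j}+1$, and satisfies $$w_1(\xi_j)=w_1^*(\xi_j)=w_2(\xi_j)=w_2^*(\xi_j)=\dots=w_d(\xi_j)=w_d^*(\xi_j)=w .$$ -/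

import Mathlib

open Polynomial

namespace LaurentExponent

noncomputable section

variable (F : Type*) [Field F] [Finite F]

/-- The field `F((T⁻¹))`.  It is Mathlib's field of formal Laurent series over `F`, whose formal
variable plays the role of `T⁻¹`: the series `∑ aₙ T⁻ⁿ` has `aₙ` as its coefficient of index `n`. -/
abbrev Series (F : Type*) [Field F] : Type _ := LaurentSeries F

/-- The embedding `F[T] → F((T⁻¹))`, sending `T` to the Laurent series `T`
(the inverse of the formal variable of `LaurentSeries F`). -/
def polyEmb (F : Type*) [Field F] : F[X] →ₐ[F] Series F :=
  Polynomial.aeval (HahnSeries.single (-1 : ℤ) (1 : F))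

open Classical in
/-- The absolute value of `F((T⁻¹))`: `|0| = 0` and `|∑_{n ≥ N} aₙ T⁻ⁿ| = q ^ (-N)` if `a_N ≠ 0`,
where `q` is the number of elements of `F`. -/
def seriesAbs : AbsoluteValue (Series F) ℝ where
  toFun x := if x = 0 then 0 else (Nat.card F : ℝ) ^ (-(HahnSeries.order x))
  map_mul' x y := by
    have hq : (Nat.card F : ℝ) ≠ 0 := by exact_mod_cast Nat.card_pos.ne'
    by_cases hx : x = 0
    · simp [hx]
    by_cases hy : y = 0
    · simp [hy]
    rw [if_neg (mul_ne_zero hx hy), if_neg hx, if_neg hy, HahnSeries.order_mul hx hy, neg_add,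
      zpow_add₀ hq]
  nonneg' x := by
    change 0 ≤ (if x = 0 then (0 : ℝ) else _)
    split_ifs <;> positivity
  eq_zero' x := by
    have hq : (Nat.card F : ℝ) ≠ 0 := by exact_mod_cast Nat.card_pos.ne'
    by_cases hx : x = 0
    · simp [hx]
    · simp [hx, zpow_ne_zero _ hq]
  add_le' x y := by
    have hq : (1 : ℝ) ≤ (Nat.card F : ℝ) := by exact_mod_cast Nat.card_pos
    have hq0 : (0 : ℝ) < (Nat.card F : ℝ) := by linarith
    by_cases hx : x = 0
    · simp [hx]
    by_cases hy : y = 0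
    · simp [hy]
    have hxp : (0 : ℝ) < (Nat.card F : ℝ) ^ (-(HahnSeries.order x)) := zpow_pos hq0 _
    have hyp : (0 : ℝ) < (Nat.card F : ℝ) ^ (-(HahnSeries.order y)) := zpow_pos hq0 _
    rw [if_neg hx, if_neg hy]
    by_cases hxy : x + y = 0
    · rw [if_pos hxy]; linarith
    rw [if_neg hxy]
    have h := HahnSeries.min_order_le_order_add hxy
    rcases min_le_iff.mp h with h1 | h1
    · have := zpow_le_zpow_right₀ hq (neg_le_neg h1)
      linarith
    · have := zpow_le_zpow_right₀ hq (neg_le_neg h1)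
      linarith

/-- An algebraic closure of `F((T⁻¹))`. -/
abbrev Closure (F : Type*) [Field F] : Type _ := AlgebraicClosure (Series F)

/-- The extension of the absolute value to the algebraic closure of `F((T⁻¹))`: the spectral norm,
with respect to the normed field structure that `seriesAbs F` gives to `F((T⁻¹))`. -/
def closureAbs (x : Closure F) : ℝ :=
  letI : NormedField (Series F) := (seriesAbs F).toNormedField
  spectralNorm (Series F) (Closure F) x

/-- `closureAbs` extends `seriesAbs`. -/
theorem closureAbs_algebraMap (x : Series F) :
    closureAbs F (algebraMap (Series F) (Closure F) x) = seriesAbs F x :=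
  letI : NormedField (Series F) := (seriesAbs F).toNormedField
  spectralNorm_extends (K := Series F) (L := Closure F) x

/-- The embedding of `F[T]` into the algebraic closure of `F((T⁻¹))`. -/
def polyEmbClosure (F : Type*) [Field F] : F[X] →+* Closure F :=
  (algebraMap (Series F) (Closure F)).comp (polyEmb F : F[X] →+* Series F)

variable {F}

/-- The height of a polynomial with coefficients in `F[T]`: the maximum of the absolute values of
its coefficients. -/
def height (P : F[X][X]) : ℝ :=
  (Finset.range (P.natDegree + 1)).sup' Finset.nonempty_range_add_one
    (fun i => seriesAbs F (polyEmb F (P.coeff i)))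

/-- `P` is the minimal polynomial over `F[T]` of the element `α` of the algebraic closure:
a non-constant irreducible primitive polynomial with coefficients in `F[T]`, with a leading
coefficient that is monic in `T`, that vanishes at `α`. An element is algebraic over `F(T)` if and
only if it has such a polynomial, which is then unique; its height and its degree are the height
and the degree of the element. -/
def IsMinPoly {F : Type*} [Field F] (α : Closure F) (P : F[X][X]) : Prop :=
  0 < P.natDegree ∧ Irreducible P ∧ P.IsPrimitive ∧ P.leadingCoeff.Monic ∧
    P.eval₂ (polyEmbClosure F) α = 0

/-- The Laurent series `ξ` is algebraic over `F(T)` of degree `m`. -/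
def IsAlgebraicOfDegree {F : Type*} [Field F] (ξ : Series F) (m : ℕ) : Prop :=
  ∃ P : F[X][X], IsMinPoly (algebraMap (Series F) (Closure F) ξ) P ∧ P.natDegree = m

/-- The exponent `w_n(ξ)`, an element of `[-∞, ∞]`. -/
def w (n : ℕ) (ξ : Series F) : EReal :=
  sSup {e : EReal | ∃ v : ℝ, e = (v : EReal) ∧
    {P : F[X][X] | P.natDegree ≤ n ∧
      0 < seriesAbs F (P.eval₂ (polyEmb F : F[X] →+* Series F) ξ) ∧
      seriesAbs F (P.eval₂ (polyEmb F : F[X] →+* Series F) ξ) ≤ height P ^ (-v)}.Infinite}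

/-- The exponent `w_n^*(ξ)`, an element of `[-∞, ∞]`. The approximations `α` range over all
elements of the algebraic closure that are algebraic over `F(T)` of degree at most `n`. -/
def wStar (n : ℕ) (ξ : Series F) : EReal :=
  sSup {e : EReal | ∃ v : ℝ, e = (v : EReal) ∧
    {α : Closure F | ∃ P : F[X][X], IsMinPoly α P ∧ P.natDegree ≤ n ∧
      0 < closureAbs F (algebraMap (Series F) (Closure F) ξ - α) ∧
      closureAbs F (algebraMap (Series F) (Closure F) ξ - α) ≤ height P ^ (-v - 1)}.Infinite}

/-- `ξ` lies in the subfield `F(T)` of `F((T⁻¹))`. -/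
def IsRational {F : Type*} [Field F] (ξ : Series F) : Prop :=
  ∃ A B : F[X], B ≠ 0 ∧ ξ = polyEmb F A / polyEmb F B

/-- Class IA, for series over a field of characteristic `p`: `α` is not in `F(T)` and
`α = (R α^(p^s) + S) / (V α^(p^s) + U)` for some `s ≥ 0` and some `R, S, V, U` in `F[T]` with
`R U - S V` a nonzero constant. For `s = 0` the matrix must not be scalar: with a scalar matrix and
`s = 0` the relation is `α = α` and says nothing. -/
def IsClassIA {F : Type*} [Field F] (p : ℕ) (α : Series F) : Prop :=
  ¬ IsRational α ∧ ∃ (s : ℕ) (R S V U : F[X]),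
    (∃ c : F, c ≠ 0 ∧ R * U - S * V = C c) ∧
    (s = 0 → ¬ (R = U ∧ S = 0 ∧ V = 0)) ∧
    α = (polyEmb F R * α ^ (p ^ s) + polyEmb F S) / (polyEmb F V * α ^ (p ^ s) + polyEmb F U)

end

end LaurentExponent

/-! The series is a continued fraction `ξ = [0; a 0, a 1, …]` with `a i = T ^ (s (i + 1) - s i)`, so
that the `n`-th denominator has degree `y n = s n - s 0`. Everything is read off the integer
sequence `s`, which satisfies `ρ s i < s (i + 1) ≤ w s i`, `s 1 = w s 0`, `s (i + (l + 1)) = p ^ k s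
i` and `p ∤ s l`.

Exponents. The `n`-th convergent gives a linear polynomial of height `q ^ y n` and value `q ^ (-y (n
+ 1))` at `ξ`. The ratio `w` recurs at every period, so all the exponents are at least `w`.
Conversely, let `P` have degree at most `d` and height `q ^ h`, and take the first convergent with
`h + (d - 1) y n < y (n + 1)`. If `P` does not vanish there, Liouville's inequality gives `|P(ξ)| ≥
q ^ (-d y n)`, and minimality of `n` bounds `d y n` by `w h + O(1)`; if it does vanish, a linear
factor is split off and the degree drops (`IsCfLimit.le_seriesAbs_eval₂`). This needs `w (d - 1) ≤
(w - d) ρ` for some `ρ < w`, which is possible exactly because `w > 2 d - 1`. The bound on `w_n`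
yields the one on `w_n^*`, since `|P(ξ)| ≤ H(P) |ξ - α|` for roots `α` in the unit disc.

Class IA and degree. Put `Q = p ^ k`. As `a (i + (l + 1)) = a i ^ Q`, Frobenius turns the shifted
fraction into `ξ ^ Q`. Hence `ξ` is a unimodular homographic image of `ξ ^ Q` and a root of
`periodPoly`, of degree `Q + 1`. Every other root has absolute value `q ^ (deg (a l) / Q)` with `deg
(a l)` prime to `p`, so a factor not vanishing at `ξ` has degree divisible by `Q`. The cofactor
would then have degree at most `1`, but `ξ` is irrational; so `periodPoly` is irreducible. -/

namespace LaurentExponent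

/-! ### Absolute values on the Laurent series field and on its algebraic closure. -/

section AbsoluteValues

variable {F : Type*} [Field F]

theorem algebraMap_series (a : F) : algebraMap F (Series F) a = HahnSeries.C a :=
  HahnSeries.ofPowerSeries_C a

theorem coeff_polyEmb (A : F[X]) (n : ℕ) : (polyEmb F A).coeff (-(n : ℤ)) = A.coeff n := by
  induction A using Polynomial.induction_on' with
  | add f g hf hg => simp [hf, hg]
  | monomial k a =>
    simp only [polyEmb, aeval_monomial, HahnSeries.single_pow, coeff_monomial, one_pow]
    rw [algebraMap_series, HahnSeries.C_mul_eq_smul,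
      HahnSeries.coeff_smul, HahnSeries.coeff_single]
    simp [eq_comm]

theorem polyEmb_injective : Function.Injective (polyEmb F) := by
  intro A B h
  ext n
  rw [← coeff_polyEmb, h, coeff_polyEmb]

theorem polyEmb_ne_zero {A : F[X]} (hA : A ≠ 0) : polyEmb F A ≠ 0 :=
  (map_ne_zero_iff _ polyEmb_injective).mpr hA

variable [Finite F]

theorem one_lt_card : (1 : ℝ) < Nat.card F := by exact_mod_cast Finite.one_lt_card

theorem card_pos : (0 : ℝ) < Nat.card F := zero_lt_one.trans one_lt_card

theorem seriesAbs_of_ne_zero {x : Series F} (hx : x ≠ 0) :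
    seriesAbs F x = (Nat.card F : ℝ) ^ (-x.order) := if_neg hx

theorem seriesAbs_le_zpow_iff {x : Series F} {n : ℤ} :
    seriesAbs F x ≤ (Nat.card F : ℝ) ^ (-n) ↔ ∀ i < n, x.coeff i = 0 := by
  by_cases hx : x = 0
  · simp [hx, (zpow_pos (card_pos (F := F)) _).le]
  rw [seriesAbs_of_ne_zero hx, zpow_le_zpow_iff_right₀ one_lt_card, neg_le_neg_iff]
  constructor
  · intro h i hi
    exact HahnSeries.coeff_eq_zero_of_lt_order (hi.trans_le h)
  · intro h
    by_contra! hlt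
    exact HahnSeries.coeff_order_eq_zero.not.mpr hx (h _ hlt)

theorem seriesAbs_add_le_max (x y : Series F) :
    seriesAbs F (x + y) ≤ max (seriesAbs F x) (seriesAbs F y) := by
  by_cases hx : x = 0
  · simp [hx]
  by_cases hy : y = 0
  · simp [hy]
  by_cases hxy : x + y = 0
  · simp [hxy, (seriesAbs F).nonneg x]
  rw [seriesAbs_of_ne_zero hx, seriesAbs_of_ne_zero hy, seriesAbs_of_ne_zero hxy, le_max_iff,
    zpow_le_zpow_iff_right₀ one_lt_card, zpow_le_zpow_iff_right₀ one_lt_card, neg_le_neg_iff,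
    neg_le_neg_iff]
  exact min_le_iff.mp (HahnSeries.min_order_le_order_add hxy)

theorem isNonarchimedean_seriesAbs : IsNonarchimedean (seriesAbs F) := seriesAbs_add_le_max

theorem seriesAbs_polyEmb {A : F[X]} (hA : A ≠ 0) :
    seriesAbs F (polyEmb F A) = (Nat.card F : ℝ) ^ A.natDegree := by
  have h0 := polyEmb_ne_zero hA
  have : (polyEmb F A).order = -(A.natDegree : ℤ) := by
    apply le_antisymm
    · apply HahnSeries.order_le_of_coeff_ne_zero
      rw [coeff_polyEmb]
      simpa using hA
    · by_contra! hlt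
      have h1 := HahnSeries.coeff_order_eq_zero.not.mpr h0
      obtain ⟨n, hn⟩ : ∃ n : ℕ, (polyEmb F A).order = -(n : ℤ) :=
        ⟨(-(polyEmb F A).order).toNat, by omega⟩
      rw [hn, coeff_polyEmb] at h1
      exact h1 (coeff_eq_zero_of_natDegree_lt (by omega))
  rw [seriesAbs_of_ne_zero h0, this, neg_neg, zpow_natCast]

theorem one_le_seriesAbs_polyEmb {A : F[X]} (hA : A ≠ 0) : 1 ≤ seriesAbs F (polyEmb F A) := by
  rw [seriesAbs_polyEmb hA]
  exact one_le_pow₀ one_lt_card.le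

/-- The coefficient of index `i` is constant from the term `i.toNat` on, so the limit is assembled
coefficient by coefficient. -/
theorem exists_limit_of_seriesAbs_sub_le (u : ℕ → Series F)
    (hu : ∀ N n, N ≤ n → seriesAbs F (u n - u N) ≤ (Nat.card F : ℝ) ^ (-((N : ℤ) + 1))) :
    ∃ ξ : Series F, ∀ n, seriesAbs F (ξ - u n) ≤ (Nat.card F : ℝ) ^ (-((n : ℤ) + 1)) := by
  have key : ∀ N n : ℕ, N ≤ n → ∀ i : ℤ, i ≤ N → (u n).coeff i = (u N).coeff i := by
    intro N n h i hi
    have := seriesAbs_le_zpow_iff.mp (hu N n h) i (by omega)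
    rwa [HahnSeries.coeff_sub, sub_eq_zero] at this
  let ξ : Series F := HahnSeries.ofSuppBddBelow (fun i : ℤ => (u i.toNat).coeff i) (by
    refine ⟨min 0 (u 0).order, ?_⟩
    intro i hi
    by_contra! hlt
    have h0 : i < 0 := hlt.trans_le (min_le_left _ _)
    have : i.toNat = 0 := by omega
    rw [Function.mem_support, this] at hi
    exact hi (HahnSeries.coeff_eq_zero_of_lt_order (hlt.trans_le (min_le_right _ _))))
  refine ⟨ξ, fun n => seriesAbs_le_zpow_iff.mpr fun i hi => ?_⟩
  have : ξ.coeff i = (u i.toNat).coeff i := rfl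
  rw [HahnSeries.coeff_sub, this, sub_eq_zero, key i.toNat n (by omega) i (by omega)]

variable (F) in
/-- `F((T⁻¹))` with the absolute value `seriesAbs`. -/
@[reducible]
noncomputable def seriesNormedField : NontriviallyNormedField (Series F) where
  toNormedField := (seriesAbs F).toNormedField
  non_trivial := ⟨polyEmb F X, by
    change 1 < seriesAbs F _
    rw [seriesAbs_polyEmb X_ne_zero, natDegree_X, pow_one]
    exact one_lt_card⟩

theorem isUltrametricDist_series :
    letI := seriesNormedField F
    IsUltrametricDist (Series F) :=
  letI := seriesNormedField F
  IsUltrametricDist.isUltrametricDist_of_isNonarchimedean_norm seriesAbs_add_le_max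

/-- Completeness is what makes the spectral norm multiplicative in `closureAbs_mul`. -/
theorem completeSpace_series :
    letI := seriesNormedField F
    @CompleteSpace (Series F) (seriesNormedField F).toPseudoMetricSpace.toUniformSpace := by
  let := seriesNormedField F
  refine @Metric.complete_of_convergent_controlled_sequences (Series F)
    (seriesNormedField F).toPseudoMetricSpace
    (fun n => (Nat.card F : ℝ) ^ (-((n : ℤ) + 1))) (fun n => zpow_pos card_pos _) ?_
  intro u hu
  obtain ⟨ξ, hξ⟩ := exists_limit_of_seriesAbs_sub_le u fun N n h => by
    have := (hu N n N h le_rfl).le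
    rwa [dist_eq_norm] at this
  refine ⟨ξ, ?_⟩
  rw [@Metric.tendsto_atTop (Series F) _ (seriesNormedField F).toPseudoMetricSpace]
  intro ε hε
  obtain ⟨N, hN⟩ := exists_pow_lt_of_lt_one hε (inv_lt_one_of_one_lt₀ (one_lt_card (F := F)))
  refine ⟨N, fun n hn => ?_⟩
  rw [dist_eq_norm]
  change seriesAbs F (u n - ξ) < ε
  rw [(seriesAbs F).map_sub]
  refine (hξ n).trans_lt (lt_of_le_of_lt ?_ hN)
  rw [inv_pow, ← zpow_natCast, ← zpow_neg]
  exact zpow_le_zpow_right₀ one_lt_card.le (by omega)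

theorem closureAbs_add_le_max (x y : Closure F) :
    closureAbs F (x + y) ≤ max (closureAbs F x) (closureAbs F y) := by
  let := seriesNormedField F
  have := isUltrametricDist_series (F := F)
  exact isNonarchimedean_spectralNorm (K := Series F) (L := Closure F) x y

theorem closureAbs_mul (x y : Closure F) :
    closureAbs F (x * y) = closureAbs F x * closureAbs F y := by
  let := seriesNormedField F
  have := isUltrametricDist_series (F := F)
  have := completeSpace_series (F := F)
  exact spectralAlgNorm_mul (K := Series F) (L := Closure F) x y

variable (F) in
/-- `closureAbs` as a bundled absolute value. -/
noncomputable def closureAbsVal : AbsoluteValue (Closure F) ℝ where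
  toFun := closureAbs F
  map_mul' := closureAbs_mul
  nonneg' x := let := seriesNormedField F; spectralNorm_nonneg (K := Series F) x
  eq_zero' x := by
    let := seriesNormedField F
    have := isUltrametricDist_series (F := F)
    exact map_eq_zero_iff_eq_zero (spectralAlgNorm (Series F) (Closure F))
  add_le' x y := by
    let := seriesNormedField F
    have := isUltrametricDist_series (F := F)
    exact map_add_le_add (spectralAlgNorm (Series F) (Closure F)) x y

theorem isNonarchimedean_closureAbsVal : IsNonarchimedean (closureAbsVal F) :=
  closureAbs_add_le_max

theorem closureAbsVal_algebraMap (x : Series F) :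
    closureAbsVal F (algebraMap (Series F) (Closure F) x) = seriesAbs F x :=
  closureAbs_algebraMap F x

end AbsoluteValues

/-! ### Heights, Gauss's lemma and Liouville's inequality. -/

section Heights

theorem abs_pow_sub_pow_le {L : Type*} [Field L] (v : AbsoluteValue L ℝ)
    (hv : IsNonarchimedean v) {x y : L} (hx : v x ≤ 1) (hy : v y ≤ 1) (n : ℕ) :
    v (x ^ n - y ^ n) ≤ v (x - y) := by
  induction n with
  | zero => simp
  | succ n ih =>
    have : x ^ (n + 1) - y ^ (n + 1) = x ^ n * (x - y) + (x ^ n - y ^ n) * y := by ring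
    rw [this]
    refine (hv _ _).trans (max_le ?_ ?_)
    · rw [map_mul, map_pow]
      exact mul_le_of_le_one_left (v.nonneg _) (pow_le_one₀ (v.nonneg _) hx)
    · rw [map_mul]
      exact (mul_le_of_le_one_right (v.nonneg _) hy).trans ih

variable {F : Type*} [Field F]

/-- Gauss's lemma: the linear polynomial is primitive, so divisibility over `F(T)` descends to
`F[T]`. -/
theorem linear_dvd_of_eval₂_div_eq_zero {P : F[X][X]} {a b : F[X]} (hb : b ≠ 0)
    (hab : IsCoprime a b)
    (h : P.eval₂ (polyEmb F : F[X] →+* Series F) (polyEmb F a / polyEmb F b) = 0) :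
    C b * X - C a ∣ P := by
  set K := FractionRing F[X]
  let φ : K →+* Series F :=
    IsFractionRing.lift (g := (polyEmb F : F[X] →+* Series F)) polyEmb_injective
  have hφ : ∀ c, φ (algebraMap F[X] K c) = polyEmb F c :=
    fun c => IsFractionRing.lift_algebraMap _ c
  have hcomp : (polyEmb F : F[X] →+* Series F) = φ.comp (algebraMap F[X] K) := by
    exact RingHom.ext fun c => (hφ c).symm
  set x : K := algebraMap F[X] K a / algebraMap F[X] K b
  have hx : φ x = polyEmb F a / polyEmb F b := by simp [x, hφ]
  have hroot : (P.map (algebraMap F[X] K)).IsRoot x := by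
    rw [IsRoot.def, eval_map, ← map_eq_zero_iff φ φ.injective, hom_eval₂, ← hcomp, hx, h]
  have hb' : algebraMap F[X] K b ≠ 0 := by simpa using hb
  have hprim : (C b * X - C a).IsPrimitive := by
    intro c hc
    rw [C_dvd_iff_dvd_coeff] at hc
    refine hab.isUnit_of_dvd' ?_ ?_
    · simpa using hc 0
    · simpa using hc 1
  refine hprim.dvd_of_fraction_map_dvd_fraction_map (K := K) ?_
  have : (C b * X - C a).map (algebraMap F[X] K) = C (algebraMap F[X] K b) * (X - C x) := by
    simp [x, mul_sub, ← C_mul, mul_div_cancel₀, hb']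
  rw [this, IsUnit.mul_left_dvd (isUnit_C.mpr (isUnit_iff_ne_zero.mpr hb'))]
  exact dvd_iff_isRoot.mpr hroot

variable [Finite F]

variable (F) in
/-- The restriction of `seriesAbs` to `F[T]`. -/
noncomputable def polyAbs : AbsoluteValue F[X] ℝ :=
  (seriesAbs F).comp (f := (polyEmb F : F[X] →+* Series F)) polyEmb_injective

theorem polyAbs_apply (A : F[X]) : polyAbs F A = seriesAbs F (polyEmb F A) := rfl

theorem isNonarchimedean_polyAbs : IsNonarchimedean (polyAbs F) := fun a b => by
  simpa [polyAbs_apply] using seriesAbs_add_le_max (polyEmb F a) (polyEmb F b)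

theorem polyAbs_coeff_le_height (P : F[X][X]) (i : ℕ) : polyAbs F (P.coeff i) ≤ height P := by
  have h0 : 0 ≤ height P := by
    refine le_trans ((seriesAbs F).nonneg _) (Finset.le_sup' (fun i =>
      seriesAbs F (polyEmb F (P.coeff i))) (b := 0) (by simp))
  rcases le_or_gt i P.natDegree with h | h
  · exact Finset.le_sup' (fun i => seriesAbs F (polyEmb F (P.coeff i))) (by simp; omega)
  · simpa [coeff_eq_zero_of_natDegree_lt h] using h0

theorem exists_height_eq (P : F[X][X]) : ∃ i, height P = polyAbs F (P.coeff i) := by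
  obtain ⟨i, -, hi⟩ := Finset.exists_mem_eq_sup' (s := Finset.range (P.natDegree + 1))
    Finset.nonempty_range_add_one (fun i => seriesAbs F (polyEmb F (P.coeff i)))
  exact ⟨i, hi⟩

theorem height_eq_gaussNorm (P : F[X][X]) : height P = P.gaussNorm (polyAbs F) 1 := by
  apply le_antisymm
  · obtain ⟨i, hi⟩ := exists_height_eq P
    have := P.le_gaussNorm (polyAbs F) zero_le_one i
    rwa [one_pow, mul_one, ← hi] at this
  · obtain ⟨i, hi⟩ := P.exists_eq_gaussNorm (polyAbs F) 1
    rw [hi, one_pow, mul_one]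
    exact polyAbs_coeff_le_height P i

/-- The height is the Gauss norm of a nonarchimedean absolute value. Multiplicativity lets linear
factors be split off without loss. -/
theorem height_mul (P Q : F[X][X]) : height (P * Q) = height P * height Q := by
  simp only [height_eq_gaussNorm]
  exact gaussNorm_mul isNonarchimedean_polyAbs zero_lt_one P Q

theorem exists_height_eq_pow {P : F[X][X]} (hP : P ≠ 0) :
    ∃ h : ℕ, height P = (Nat.card F : ℝ) ^ h := by
  obtain ⟨i, hi⟩ := exists_height_eq P
  have h1 : 1 ≤ polyAbs F P.leadingCoeff :=
    one_le_seriesAbs_polyEmb (leadingCoeff_ne_zero.mpr hP)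
  have hne : P.coeff i ≠ 0 := by
    intro h0
    have := h1.trans (polyAbs_coeff_le_height P P.natDegree)
    rw [hi, h0, map_zero] at this
    norm_num at this
  exact ⟨_, hi.trans (seriesAbs_polyEmb hne)⟩

theorem height_linear {a b : F[X]} (hb : b ≠ 0) (hab : a.natDegree ≤ b.natDegree) :
    height (C b * X - C a) = (Nat.card F : ℝ) ^ b.natDegree := by
  apply le_antisymm
  · obtain ⟨i, hi⟩ := exists_height_eq (C b * X - C a)
    rw [hi]
    rcases i with - | i
    · simp only [coeff_sub, mul_coeff_zero, coeff_C_zero, coeff_X_zero, mul_zero, zero_sub]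
      rw [AbsoluteValue.map_neg]
      by_cases ha : a = 0
      · simp [ha]
      · rw [polyAbs_apply, seriesAbs_polyEmb ha]
        exact pow_le_pow_right₀ one_lt_card.le hab
    · rcases i with - | i
      · simp [polyAbs_apply, seriesAbs_polyEmb hb]
      · simp
  · have := polyAbs_coeff_le_height (C b * X - C a) 1
    simpa [polyAbs_apply, seriesAbs_polyEmb hb] using this

theorem finite_setOf_height_le (n : ℕ) (B : ℝ) :
    {P : F[X][X] | P.natDegree ≤ n ∧ height P ≤ B}.Finite := by
  obtain ⟨D, hD⟩ := pow_unbounded_of_one_lt B (one_lt_card (F := F))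
  have hfin : ∀ {R : Type _} [Semiring R] (S : Set R) (_ : S.Finite) (m : ℕ),
      {p : R[X] | p.natDegree ≤ m ∧ ∀ i, p.coeff i ∈ S}.Finite := by
    intro R _ S hS m
    refine Set.Finite.of_finite_image (f := fun p (i : Fin (m + 1)) => p.coeff i)
      ((Set.Finite.pi fun _ : Fin (m + 1) => hS).subset ?_) ?_
    · rintro _ ⟨p, hp, rfl⟩ i -
      exact hp.2 i
    · intro p hp q hq h
      ext i
      by_cases hi : i < m + 1
      · exact congrFun h ⟨i, hi⟩
      · rw [coeff_eq_zero_of_natDegree_lt (by have := hp.1; omega),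
          coeff_eq_zero_of_natDegree_lt (by have := hq.1; omega)]
  refine (hfin _ (hfin (Set.univ : Set F) Set.finite_univ D) n).subset ?_
  rintro P ⟨hn, hB⟩
  refine ⟨hn, fun i => ⟨?_, fun _ => Set.mem_univ _⟩⟩
  by_cases h0 : P.coeff i = 0
  · simp [h0]
  have := ((polyAbs_coeff_le_height P i).trans hB).trans_lt hD
  rw [polyAbs_apply, seriesAbs_polyEmb h0, pow_lt_pow_iff_right₀ one_lt_card] at this
  exact this.le

theorem abs_eval₂_sub_le {L : Type*} [Field L] (v : AbsoluteValue L ℝ) (hv : IsNonarchimedean v)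
    (i : F[X] →+* L) (hi : ∀ a, v (i a) = polyAbs F a) (P : F[X][X]) {x y : L}
    (hx : v x ≤ 1) (hy : v y ≤ 1) :
    v (P.eval₂ i x - P.eval₂ i y) ≤ height P * v (x - y) := by
  rw [eval₂_eq_sum_range, eval₂_eq_sum_range, ← Finset.sum_sub_distrib]
  obtain ⟨k, -, hk⟩ := hv.finset_image_add_of_nonempty
    (fun k => i (P.coeff k) * x ^ k - i (P.coeff k) * y ^ k)
    (t := Finset.range (P.natDegree + 1)) Finset.nonempty_range_add_one
  refine hk.trans ?_
  rw [← mul_sub, map_mul, hi]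
  exact mul_le_mul (polyAbs_coeff_le_height P k) (abs_pow_sub_pow_le v hv hx hy k) (v.nonneg _)
    (((polyAbs F).nonneg _).trans (polyAbs_coeff_le_height P k))

/-- Liouville's inequality: `b ^ n P(a / b)` is a nonzero element of `F[T]`, so its absolute value
is at least `1`. -/
theorem inv_pow_le_abs_eval₂_div {P : F[X][X]} {n : ℕ} (hn : P.natDegree ≤ n) {a b : F[X]}
    (hb : b ≠ 0) (h : P.eval₂ (polyEmb F : F[X] →+* Series F) (polyEmb F a / polyEmb F b) ≠ 0) :
    ((polyAbs F b) ^ n)⁻¹ ≤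
      seriesAbs F (P.eval₂ (polyEmb F : F[X] →+* Series F) (polyEmb F a / polyEmb F b)) := by
  have hb' := polyEmb_ne_zero hb
  obtain ⟨D, bi, hbi, hD⟩ := denomsClearable_of_natDegree_le (i := (polyEmb F : F[X] →+* Series F))
    (b := b) (bi := (polyEmb F b)⁻¹) n a (inv_mul_cancel₀ hb') P hn
  have hbi' : bi = (polyEmb F b)⁻¹ := eq_inv_of_mul_eq_one_left hbi
  rw [hbi', eval_map, ← div_eq_mul_inv] at hD
  replace hD : polyEmb F D = polyEmb F b ^ n * P.eval₂ (polyEmb F : F[X] →+* Series F)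
    (polyEmb F a / polyEmb F b) := hD
  have hD0 : D ≠ 0 := by
    rintro rfl
    rw [map_zero] at hD
    exact mul_ne_zero (pow_ne_zero n hb') h hD.symm
  have h1 := one_le_seriesAbs_polyEmb hD0
  rw [hD, map_mul, map_pow] at h1
  exact (inv_le_iff_one_le_mul₀' (pow_pos ((polyAbs F).pos hb) n)).mpr h1

end Heights

/-! ### Continued fractions with monic partial quotients. -/

section ContinuedFractions

/-- The numerators of the convergents of `[0; a 0, a 1, …]`. -/
def cfNum {R : Type*} [CommRing R] (a : ℕ → R) : ℕ → R
  | 0 => 0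
  | 1 => 1
  | n + 2 => a (n + 1) * cfNum a (n + 1) + cfNum a n

/-- The denominators of the convergents of `[0; a 0, a 1, …]`. -/
def cfDen {R : Type*} [CommRing R] (a : ℕ → R) : ℕ → R
  | 0 => 1
  | 1 => a 0
  | n + 2 => a (n + 1) * cfDen a (n + 1) + cfDen a n

theorem cfNum_map {R S : Type*} [CommRing R] [CommRing S] (φ : R →+* S) (a : ℕ → R) :
    ∀ n, cfNum (fun i => φ (a i)) n = φ (cfNum a n)
  | 0 => by simp [cfNum]
  | 1 => by simp [cfNum]
  | n + 2 => by simp [cfNum, cfNum_map φ a (n + 1), cfNum_map φ a n]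

theorem cfDen_map {R S : Type*} [CommRing R] [CommRing S] (φ : R →+* S) (a : ℕ → R) :
    ∀ n, cfDen (fun i => φ (a i)) n = φ (cfDen a n)
  | 0 => by simp [cfDen]
  | 1 => by simp [cfDen]
  | n + 2 => by simp [cfDen, cfDen_map φ a (n + 1), cfDen_map φ a n]

/-- With `cfDen_add`, this expresses a convergent as a homographic image of a convergent of the
shifted fraction; the functional equation rests on it. -/
theorem cfNum_add {R : Type*} [CommRing R] (a : ℕ → R) (m : ℕ) :
    ∀ n, cfNum a (n + (m + 1)) = cfNum a (m + 1) * cfDen (fun i => a (i + (m + 1))) n +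
      cfNum a m * cfNum (fun i => a (i + (m + 1))) n
  | 0 => by simp [cfNum, cfDen]
  | 1 => by
    rw [show 1 + (m + 1) = m + 2 by ring]
    simp [cfNum, cfDen, mul_comm]
  | n + 2 => by
    have h1 := cfNum_add a m (n + 1)
    have h0 := cfNum_add a m n
    rw [show n + 2 + (m + 1) = (n + (m + 1)) + 2 by ring, cfNum, h0,
      show n + (m + 1) + 1 = n + 1 + (m + 1) by ring, h1]
    simp only [cfNum, cfDen]
    ring

theorem cfDen_add {R : Type*} [CommRing R] (a : ℕ → R) (m : ℕ) :
    ∀ n, cfDen a (n + (m + 1)) = cfDen a (m + 1) * cfDen (fun i => a (i + (m + 1))) n +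
      cfDen a m * cfNum (fun i => a (i + (m + 1))) n
  | 0 => by simp [cfNum, cfDen]
  | 1 => by
    rw [show 1 + (m + 1) = m + 2 by ring]
    simp [cfNum, cfDen, mul_comm]
  | n + 2 => by
    have h1 := cfDen_add a m (n + 1)
    have h0 := cfDen_add a m n
    rw [show n + 2 + (m + 1) = (n + (m + 1)) + 2 by ring, cfDen, h0,
      show n + (m + 1) + 1 = n + 1 + (m + 1) by ring, h1]
    simp only [cfNum, cfDen]
    ring

theorem cfNum_mul_cfDen_sub {R : Type*} [CommRing R] (a : ℕ → R) (n : ℕ) :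
    cfNum a (n + 1) * cfDen a n - cfNum a n * cfDen a (n + 1) = (-1) ^ n := by
  induction n with
  | zero => simp [cfNum, cfDen]
  | succ n ih =>
    rw [pow_succ, ← ih]
    simp only [cfNum, cfDen]
    ring

theorem isCoprime_cfNum_cfDen {R : Type*} [CommRing R] (a : ℕ → R) (n : ℕ) :
    IsCoprime (cfNum a n) (cfDen a n) := by
  refine ⟨-(-1) ^ n * cfDen a (n + 1), (-1) ^ n * cfNum a (n + 1), ?_⟩
  have := cfNum_mul_cfDen_sub a n
  have hsq : ((-1 : R) ^ n) * (-1) ^ n = 1 := by rw [← mul_pow]; simp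
  linear_combination (-1) ^ n * this + hsq

variable {F : Type*} [Field F] {a : ℕ → F[X]}

theorem monic_cfDen_and_natDegree (ha : ∀ i, (a i).Monic) (hd : ∀ i, 0 < (a i).natDegree) :
    ∀ n, (cfDen a n).Monic ∧ (cfDen a (n + 1)).Monic ∧
      (cfDen a (n + 1)).natDegree = (a n).natDegree + (cfDen a n).natDegree
  | 0 => by simp [cfDen, ha 0]
  | n + 1 => by
    obtain ⟨h0, h1, h2⟩ := monic_cfDen_and_natDegree ha hd n
    have hm : (a (n + 1) * cfDen a (n + 1)).Monic := (ha _).mul h1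
    have hlt : (cfDen a n).degree < (a (n + 1) * cfDen a (n + 1)).degree := by
      rw [degree_eq_natDegree h0.ne_zero, degree_eq_natDegree hm.ne_zero, (ha _).natDegree_mul h1]
      have := hd n
      exact_mod_cast (by omega)
    refine ⟨h1, hm.add_of_left hlt, ?_⟩
    rw [← (ha _).natDegree_mul h1]
    exact natDegree_add_eq_left_of_degree_lt hlt

theorem monic_cfDen (ha : ∀ i, (a i).Monic) (hd : ∀ i, 0 < (a i).natDegree) (n : ℕ) :
    (cfDen a n).Monic := (monic_cfDen_and_natDegree ha hd n).1

theorem natDegree_cfDen_succ (ha : ∀ i, (a i).Monic) (hd : ∀ i, 0 < (a i).natDegree) (n : ℕ) :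
    (cfDen a (n + 1)).natDegree = (a n).natDegree + (cfDen a n).natDegree :=
  (monic_cfDen_and_natDegree ha hd n).2.2

theorem natDegree_cfNum_le (ha : ∀ i, (a i).Monic) (hd : ∀ i, 0 < (a i).natDegree) :
    ∀ n, (cfNum a n).natDegree ≤ (cfDen a n).natDegree
  | 0 => by simp [cfNum]
  | 1 => by simp [cfNum]
  | n + 2 => by
    have h0 := natDegree_cfNum_le ha hd n
    have h1 := natDegree_cfNum_le ha hd (n + 1)
    have e0 := natDegree_cfDen_succ ha hd n
    have e1 := natDegree_cfDen_succ ha hd (n + 1)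
    rw [e1, cfNum]
    refine (natDegree_add_le _ _).trans (max_le (natDegree_mul_le.trans ?_) ?_) <;> omega

theorem le_natDegree_cfDen (ha : ∀ i, (a i).Monic) (hd : ∀ i, 0 < (a i).natDegree) (n : ℕ) :
    n ≤ (cfDen a n).natDegree := by
  induction n with
  | zero => simp
  | succ n ih =>
    rw [natDegree_cfDen_succ ha hd]
    have := hd n
    omega

/-- The `n`-th convergent of `[0; a 0, a 1, …]`. -/
noncomputable def convergent (a : ℕ → F[X]) (n : ℕ) : Series F :=
  polyEmb F (cfNum a n) / polyEmb F (cfDen a n)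

variable [Finite F]

theorem seriesAbs_convergent_succ_sub (ha : ∀ i, (a i).Monic) (hd : ∀ i, 0 < (a i).natDegree)
    (n : ℕ) : seriesAbs F (convergent a (n + 1) - convergent a n) =
      (Nat.card F : ℝ) ^ (-((cfDen a n).natDegree + (cfDen a (n + 1)).natDegree : ℤ)) := by
  have h0 := (monic_cfDen ha hd n).ne_zero
  have h1 := (monic_cfDen ha hd (n + 1)).ne_zero
  have : convergent a (n + 1) - convergent a n =
      polyEmb F ((-1) ^ n) / (polyEmb F (cfDen a (n + 1)) * polyEmb F (cfDen a n)) := by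
    rw [convergent, convergent, div_sub_div _ _ (polyEmb_ne_zero h1) (polyEmb_ne_zero h0),
      ← cfNum_mul_cfDen_sub a n]
    simp only [map_sub, map_mul]
    ring
  have hone : seriesAbs F (polyEmb F ((-1) ^ n)) = 1 := by
    rw [seriesAbs_polyEmb (by simp)]
    simp
  rw [this, map_div₀, map_mul, hone, seriesAbs_polyEmb h0, seriesAbs_polyEmb h1, zpow_neg,
    ← pow_add, one_div, ← Nat.cast_add, zpow_natCast, add_comm]

theorem seriesAbs_convergent_sub_le (ha : ∀ i, (a i).Monic) (hd : ∀ i, 0 < (a i).natDegree)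
    (N n : ℕ) (h : N ≤ n) : seriesAbs F (convergent a n - convergent a N) ≤
      (Nat.card F : ℝ) ^ (-((cfDen a N).natDegree + (cfDen a (N + 1)).natDegree : ℤ)) := by
  have hmono : Monotone fun n => (cfDen a n).natDegree :=
    monotone_nat_of_le_succ fun n => by
      rw [natDegree_cfDen_succ ha hd]
      omega
  induction n, h using Nat.le_induction with
  | base => simpa using (zpow_pos card_pos _).le
  | succ n hn ih =>
    rw [← sub_add_sub_cancel _ (convergent a n)]
    refine (seriesAbs_add_le_max _ _).trans (max_le ?_ ih)
    rw [seriesAbs_convergent_succ_sub ha hd]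
    have h1 : (cfDen a N).natDegree ≤ (cfDen a n).natDegree := hmono hn
    have h2 : (cfDen a (N + 1)).natDegree ≤ (cfDen a (n + 1)).natDegree := hmono (by omega)
    exact zpow_le_zpow_right₀ one_lt_card.le (by omega)

/-- The distances are exact because the first difference `convergent a (n + 1) - convergent a n`
strictly dominates the rest. -/
theorem exists_continuedFraction (ha : ∀ i, (a i).Monic) (hd : ∀ i, 0 < (a i).natDegree) :
    ∃ ξ : Series F, ∀ n, seriesAbs F (ξ - convergent a n) =
      (Nat.card F : ℝ) ^ (-((cfDen a n).natDegree + (cfDen a (n + 1)).natDegree : ℤ)) := by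
  obtain ⟨ξ, hξ⟩ := exists_limit_of_seriesAbs_sub_le (convergent a) fun N n h => by
    refine (seriesAbs_convergent_sub_le ha hd N n h).trans
      (zpow_le_zpow_right₀ one_lt_card.le ?_)
    have := le_natDegree_cfDen ha hd N
    have := le_natDegree_cfDen ha hd (N + 1)
    omega
  have hle : ∀ N, seriesAbs F (ξ - convergent a N) ≤
      (Nat.card F : ℝ) ^ (-((cfDen a N).natDegree + (cfDen a (N + 1)).natDegree : ℤ)) := by
    intro N
    -- An index so large that the distance from `ξ` to that convergent is negligible.
    set n := max N ((cfDen a N).natDegree + (cfDen a (N + 1)).natDegree) with hn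
    rw [← sub_add_sub_cancel _ (convergent a n)]
    refine (seriesAbs_add_le_max _ _).trans (max_le ((hξ n).trans
      (zpow_le_zpow_right₀ one_lt_card.le (by omega)))
      (seriesAbs_convergent_sub_le ha hd N n (le_max_left _ _)))
  refine ⟨ξ, fun n => ?_⟩
  rw [← seriesAbs_convergent_succ_sub ha hd, ← sub_add_sub_cancel ξ (convergent a (n + 1))]
  refine isNonarchimedean_seriesAbs.add_eq_right_of_lt ((hle (n + 1)).trans_lt ?_)
  rw [seriesAbs_convergent_succ_sub ha hd]
  refine zpow_lt_zpow_right₀ one_lt_card ?_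
  have e1 := natDegree_cfDen_succ ha hd n
  have e2 := natDegree_cfDen_succ ha hd (n + 1)
  have := hd n
  have := hd (n + 1)
  omega

end ContinuedFractions

/-! ### Lower bound for the values at `ξ` of polynomials of bounded degree. -/

section LowerBound

variable {F : Type*} [Field F] {a : ℕ → F[X]}

/-- The polynomial of degree one that vanishes at the `n`-th convergent. -/
noncomputable def convergentPoly (a : ℕ → F[X]) (n : ℕ) : F[X][X] :=
  C (cfDen a n) * X - C (cfNum a n)

theorem natDegree_convergentPoly (ha : ∀ i, (a i).Monic) (hd : ∀ i, 0 < (a i).natDegree) (n : ℕ) :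
    (convergentPoly a n).natDegree = 1 := by
  rw [convergentPoly, natDegree_sub_C, natDegree_C_mul_X _ (monic_cfDen ha hd n).ne_zero]

variable [Finite F]

theorem seriesAbs_convergent_le_one (ha : ∀ i, (a i).Monic) (hd : ∀ i, 0 < (a i).natDegree)
    (n : ℕ) : seriesAbs F (convergent a n) ≤ 1 := by
  have h0 := (monic_cfDen ha hd n).ne_zero
  rw [convergent, map_div₀, seriesAbs_polyEmb h0, div_le_one (pow_pos card_pos _)]
  by_cases h1 : cfNum a n = 0
  · simp [h1]
  · rw [seriesAbs_polyEmb h1]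
    exact pow_le_pow_right₀ one_lt_card.le (natDegree_cfNum_le ha hd n)

/-- `ξ` is the value of the continued fraction `[0; a 0, a 1, …]`. -/
def IsCfLimit (a : ℕ → F[X]) (ξ : Series F) : Prop :=
  ∀ n, seriesAbs F (ξ - convergent a n) =
    (Nat.card F : ℝ) ^ (-((cfDen a n).natDegree + (cfDen a (n + 1)).natDegree : ℤ))

variable {ξ : Series F}

theorem IsCfLimit.seriesAbs_eq (hξ : IsCfLimit a ξ) :
    seriesAbs F ξ = (Nat.card F : ℝ) ^ (-((a 0).natDegree : ℤ)) := by
  simpa [convergent, cfNum, cfDen] using hξ 0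

theorem IsCfLimit.seriesAbs_lt_one (hd : ∀ i, 0 < (a i).natDegree) (hξ : IsCfLimit a ξ) :
    seriesAbs F ξ < 1 := by
  rw [hξ.seriesAbs_eq, ← zpow_zero (Nat.card F : ℝ)]
  have := hd 0
  exact zpow_lt_zpow_right₀ one_lt_card (by omega)

theorem height_convergentPoly (ha : ∀ i, (a i).Monic) (hd : ∀ i, 0 < (a i).natDegree) (n : ℕ) :
    height (convergentPoly a n) = (Nat.card F : ℝ) ^ (cfDen a n).natDegree :=
  height_linear (monic_cfDen ha hd n).ne_zero (natDegree_cfNum_le ha hd n)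

theorem IsCfLimit.seriesAbs_convergentPoly (ha : ∀ i, (a i).Monic)
    (hd : ∀ i, 0 < (a i).natDegree) (hξ : IsCfLimit a ξ) (n : ℕ) :
    seriesAbs F ((convergentPoly a n).eval₂ (polyEmb F : F[X] →+* Series F) ξ) =
      (Nat.card F : ℝ) ^ (-((cfDen a (n + 1)).natDegree : ℤ)) := by
  have h0 := (monic_cfDen ha hd n).ne_zero
  have : (convergentPoly a n).eval₂ (polyEmb F : F[X] →+* Series F) ξ =
      polyEmb F (cfDen a n) * (ξ - convergent a n) := by
    rw [convergent, mul_sub, mul_div_cancel₀ _ (polyEmb_ne_zero h0)]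
    simp [convergentPoly]
  rw [this, map_mul, hξ n, seriesAbs_polyEmb h0, ← zpow_natCast, ← zpow_add₀ card_pos.ne']
  congr 1
  ring

/-- One convergent, chosen according to the height of `P`, is so close to `ξ` that `P` has the same
absolute value at both unless it vanishes at the convergent. -/
theorem IsCfLimit.le_seriesAbs_eval₂_or_exists_root (ha : ∀ i, (a i).Monic)
    (hd : ∀ i, 0 < (a i).natDegree) (hξ : IsCfLimit a ξ) {d : ℕ} {w K : ℝ} (hw : 0 ≤ w)
    (hK : 0 ≤ K)
    (h2 : ∀ n, (d : ℝ) * (cfDen a (n + 1)).natDegree ≤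
      w * ((cfDen a (n + 1)).natDegree - (d - 1) * (cfDen a n).natDegree) + K)
    (h3 : ∀ h : ℕ, ∃ n, (h : ℝ) + (d - 1) * (cfDen a n).natDegree < (cfDen a (n + 1)).natDegree)
    {P : F[X][X]} (hPd : P.natDegree ≤ d) {h : ℕ} (hh : height P = (Nat.card F : ℝ) ^ h) :
    (∃ n, P.eval₂ (polyEmb F : F[X] →+* Series F) (convergent a n) = 0) ∨
      (Nat.card F : ℝ) ^ (-(w * h + K)) ≤
        seriesAbs F (P.eval₂ (polyEmb F : F[X] →+* Series F) ξ) := by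
  classical
  -- The least index at which `H(P) |ξ - convergent a k|` falls below the Liouville bound `q ^ (-d y
  -- k)`.
  set k := Nat.find (h3 h) with hk
  have hk1 := Nat.find_spec (h3 h)
  rw [← hk] at hk1
  by_cases h0 : P.eval₂ (polyEmb F : F[X] →+* Series F) (convergent a k) = 0
  · exact Or.inl ⟨k, h0⟩
  right
  have hden := (monic_cfDen ha hd k).ne_zero
  -- Minimality at `k - 1` bounds `h` from below by `y k - (d - 1) y (k - 1)`, and `h2` converts
  -- this.
  have hbd : (d : ℝ) * (cfDen a k).natDegree ≤ w * h + K := by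
    rcases hkk : k with - | j
    · simp only [cfDen, natDegree_one, Nat.cast_zero, mul_zero]
      positivity
    · have hj := Nat.find_min (h3 h) (m := j) (by omega)
      rw [not_lt] at hj
      refine (h2 j).trans ?_
      have := mul_le_mul_of_nonneg_left (sub_le_iff_le_add.mpr hj) hw
      linarith
  have hlow := inv_pow_le_abs_eval₂_div hPd hden h0
  rw [polyAbs_apply, seriesAbs_polyEmb hden, ← pow_mul] at hlow
  change _ ≤ seriesAbs F (P.eval₂ (polyEmb F : F[X] →+* Series F) (convergent a k)) at hlow
  have hdist := abs_eval₂_sub_le (seriesAbs F) isNonarchimedean_seriesAbs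
    (polyEmb F : F[X] →+* Series F) (fun _ => rfl) P (hξ.seriesAbs_lt_one hd).le
    (seriesAbs_convergent_le_one ha hd k)
  have hlt : height P * seriesAbs F (ξ - convergent a k) <
      ((Nat.card F : ℝ) ^ ((cfDen a k).natDegree * d))⁻¹ := by
    rw [hh, hξ k, ← zpow_natCast, ← zpow_add₀ card_pos.ne', ← zpow_natCast, ← zpow_neg]
    refine zpow_lt_zpow_right₀ one_lt_card ?_
    have : (h : ℝ) + -((cfDen a k).natDegree + (cfDen a (k + 1)).natDegree) <
      -((cfDen a k).natDegree * d) := by linarith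
    exact_mod_cast this
  have heq : seriesAbs F (P.eval₂ (polyEmb F : F[X] →+* Series F) ξ) =
      seriesAbs F (P.eval₂ (polyEmb F : F[X] →+* Series F) (convergent a k)) := by
    have := isNonarchimedean_seriesAbs.add_eq_right_of_lt
      (hdist.trans_lt (hlt.trans_le hlow))
    rwa [sub_add_cancel] at this
  rw [heq]
  refine le_trans ?_ hlow
  rw [← Real.rpow_natCast, ← Real.rpow_neg card_pos.le]
  refine Real.rpow_le_rpow_of_exponent_le one_lt_card.le ?_
  push_cast
  linarith

/-- Induction on the degree: when `P` vanishes at a convergent, its linear factor is bounded by `h1`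
at the cost of one more factor `q ^ (-K)`, and heights multiply. -/
theorem IsCfLimit.le_seriesAbs_eval₂ (ha : ∀ i, (a i).Monic)
    (hd : ∀ i, 0 < (a i).natDegree) (hξ : IsCfLimit a ξ) {d : ℕ} {w K : ℝ} (hw : 0 ≤ w)
    (hK : 0 ≤ K)
    (h1 : ∀ n, ((cfDen a (n + 1)).natDegree : ℝ) ≤ w * (cfDen a n).natDegree + K)
    (h2 : ∀ n, (d : ℝ) * (cfDen a (n + 1)).natDegree ≤
      w * ((cfDen a (n + 1)).natDegree - (d - 1) * (cfDen a n).natDegree) + K)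
    (h3 : ∀ h : ℕ, ∃ n, (h : ℝ) + (d - 1) * (cfDen a n).natDegree < (cfDen a (n + 1)).natDegree)
    {m : ℕ} (hm : m ≤ d) {P : F[X][X]} (hP : P ≠ 0) (hPm : P.natDegree ≤ m) :
    (Nat.card F : ℝ) ^ (-(K * (m + 1))) * height P ^ (-w) ≤
        seriesAbs F (P.eval₂ (polyEmb F : F[X] →+* Series F) ξ) := by
  induction m generalizing P with
  | zero =>
    obtain ⟨h, hh⟩ := exists_height_eq_pow hP
    rcases hξ.le_seriesAbs_eval₂_or_exists_root ha hd hw hK h2 h3 (hPm.trans hm) hh with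
      ⟨n, hn⟩ | hle
    · rw [eq_C_of_natDegree_le_zero hPm, eval₂_C] at hn
      refine absurd ?_ hP
      rw [eq_C_of_natDegree_le_zero hPm, (map_eq_zero_iff _ polyEmb_injective).mp hn, C_0]
    · refine le_trans (le_of_eq ?_) hle
      rw [hh, ← Real.rpow_natCast, ← Real.rpow_mul card_pos.le, ← Real.rpow_add card_pos]
      congr 1
      push_cast
      ring
  | succ m ih =>
    obtain ⟨h, hh⟩ := exists_height_eq_pow hP
    rcases hξ.le_seriesAbs_eval₂_or_exists_root ha hd hw hK h2 h3 (hPm.trans hm) hh with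
      ⟨n, hn⟩ | hle
    · obtain ⟨Q, hQ⟩ := linear_dvd_of_eval₂_div_eq_zero (monic_cfDen ha hd n).ne_zero
        (isCoprime_cfNum_cfDen a n) hn
      change P = convergentPoly a n * Q at hQ
      have hL := natDegree_convergentPoly ha hd n
      have hQ0 : Q ≠ 0 := right_ne_zero_of_mul (hQ ▸ hP)
      have hL0 : convergentPoly a n ≠ 0 := left_ne_zero_of_mul (hQ ▸ hP)
      have hdeg := natDegree_mul hL0 hQ0
      rw [← hQ, hL] at hdeg
      have ihQ := ih (by omega) hQ0 (by omega)
      obtain ⟨h', hh'⟩ := exists_height_eq_pow hQ0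
      have hLξ := hξ.seriesAbs_convergentPoly ha hd n
      rw [hQ, eval₂_mul, map_mul, hLξ, height_mul, height_convergentPoly ha hd,
        Real.mul_rpow (by positivity) (by rw [hh']; positivity)]
      have hLle : (Nat.card F : ℝ) ^ (-K) * ((Nat.card F : ℝ) ^ (cfDen a n).natDegree) ^ (-w) ≤
          (Nat.card F : ℝ) ^ (-((cfDen a (n + 1)).natDegree : ℤ)) := by
        rw [← Real.rpow_natCast, ← Real.rpow_mul card_pos.le, ← Real.rpow_add card_pos,
          ← Real.rpow_intCast]
        refine Real.rpow_le_rpow_of_exponent_le one_lt_card.le ?_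
        push_cast
        linarith [h1 n]
      refine le_trans (le_of_eq ?_) (mul_le_mul hLle ihQ (by rw [hh']; positivity) (by positivity))
      have : (Nat.card F : ℝ) ^ (-(K * ((m + 1 : ℕ) + 1))) =
          (Nat.card F : ℝ) ^ (-K) * (Nat.card F : ℝ) ^ (-(K * ((m : ℝ) + 1))) := by
        rw [← Real.rpow_add card_pos]
        congr 1
        push_cast
        ring
      rw [this]
      ring
    · refine le_trans ?_ hle
      rw [hh, ← Real.rpow_natCast, ← Real.rpow_mul card_pos.le, ← Real.rpow_add card_pos]
      refine Real.rpow_le_rpow_of_exponent_le one_lt_card.le ?_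
      push_cast
      nlinarith [mul_nonneg hK (Nat.cast_nonneg (α := ℝ) m)]

end LowerBound

/-! ### The integer sequence that prescribes the degrees. -/

section GrowthSequence

open Filter Topology

/-- One period follows the real model `b, c, c r, …, c r ^ l = Q b`: a first jump by `w = c / b`,
then ratio `r` strictly between `ρ` and `w`. Scaled by a large `N`, it can be rounded to integers
without breaking the strict inequalities. -/
theorem exists_growth_period {p : ℕ} (hp : p.Prime) {l b c Q : ℕ} (hl : 2 ≤ l) (hb : 0 < b)
    (hc : 0 < c) {ρ r w : ℝ} (hρ : 0 < ρ) (hρr : ρ < r) (hrw : r < w) (hw : w * b = c)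
    (hQ : c * r ^ l = Q * b) :
    ∃ t : ℕ → ℕ, (∀ i ≤ l, ρ * t i < t (i + 1) ∧ (t (i + 1) : ℝ) ≤ w * t i) ∧
      (t 1 : ℝ) = w * t 0 ∧ t (l + 1) = Q * t 0 ∧ ¬ p ∣ t l := by
  have hr : 0 < r := hρ.trans hρr
  have hb' : (0 : ℝ) < b := by exact_mod_cast hb
  have hc' : (0 : ℝ) < c := by exact_mod_cast hc
  have hp' : (0 : ℝ) < p := by exact_mod_cast hp.pos
  let g : ℕ → ℝ := fun i => if i = 0 then b else c * r ^ (i - 1)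
  -- The terms of index `0`, `1`, `l + 1` are exact; the others are rounded to be `1` modulo `p`,
  -- among them that of index `l`, since `2 ≤ l`.
  let t : ℕ → ℕ → ℕ := fun N i => if i = 0 then N * b else if i = 1 then N * c else
    if i = l + 1 then Q * (N * b) else p * ⌊g i / p * N⌋₊ + 1
  have hg0 : ∀ i, 0 < g i := fun i => by
    simp only [g]
    split_ifs <;> positivity
  have ht : ∀ i, Tendsto (fun N : ℕ => (t N i : ℝ) / N) atTop (𝓝 (g i)) := by
    intro i
    have hconst : ∀ x : ℝ, Tendsto (fun N : ℕ => (N : ℝ) * x / N) atTop (𝓝 x) := by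
      intro x
      refine tendsto_const_nhds.congr' ?_
      filter_upwards [eventually_gt_atTop 0] with N hN
      have : (N : ℝ) ≠ 0 := by exact_mod_cast hN.ne'
      field_simp
    by_cases h0 : i = 0
    · simpa [t, g, h0] using hconst b
    by_cases h1 : i = 1
    · simpa [t, g, h1] using hconst c
    by_cases h2 : i = l + 1
    · have := hconst (Q * b)
      simp only [t, g, h2]
      simp only [← hQ] at this
      refine (this.congr fun N => ?_)
      have h3 : l + 1 ≠ 1 := by omega
      simp only [Nat.add_eq_zero_iff, one_ne_zero, and_false, if_false, h3, if_true]
      push_cast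
      rw [hQ]
      ring
    · simp only [t, h0, h1, h2, if_false]
      have hfl := (tendsto_nat_floor_mul_div_atTop (R := ℝ) (a := g i / p)
        (by have := hg0 i; positivity)).comp tendsto_natCast_atTop_atTop
      have h4 := (hfl.const_mul (p : ℝ)).add
        (tendsto_one_div_atTop_nhds_zero_nat (𝕜 := ℝ))
      rw [mul_div_cancel₀ _ hp'.ne', add_zero] at h4
      refine h4.congr fun N => ?_
      simp only [Function.comp_apply]
      push_cast
      ring
  have hgρ : ∀ i, ρ * g i < g (i + 1) := by
    intro i
    rcases i with - | i
    · simp only [g, if_true, Nat.add_eq_zero_iff, one_ne_zero, and_false, if_false]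
      simp only [zero_add, Nat.sub_self, pow_zero, mul_one, ← hw]
      gcongr
      linarith
    · simp only [g, Nat.add_eq_zero_iff, one_ne_zero, and_false, if_false, Nat.add_sub_cancel]
      rw [pow_succ]
      have : 0 < (c : ℝ) * r ^ i := by positivity
      nlinarith
  have hgw : ∀ i, g (i + 1 + 1) < w * g (i + 1) := by
    intro i
    simp only [g, Nat.add_eq_zero_iff, one_ne_zero, and_false, if_false, Nat.add_sub_cancel]
    rw [pow_succ]
    have : 0 < (c : ℝ) * r ^ i := by positivity
    nlinarith
  have hev : ∀ i, ∀ᶠ N : ℕ in atTop,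
      ρ * t N i < t N (i + 1) ∧ (t N (i + 1) : ℝ) ≤ w * t N i := by
    intro i
    have e1 := ((ht i).const_mul ρ).eventually_lt (ht (i + 1)) (hgρ i)
    have e2 : ∀ᶠ N : ℕ in atTop, (t N (i + 1) : ℝ) ≤ w * t N i := by
      rcases i with - | i
      · refine Eventually.of_forall fun N => le_of_eq ?_
        simp only [t, zero_add, one_ne_zero, if_false, if_true]
        push_cast
        rw [← hw]
        ring
      · filter_upwards [((ht (i + 1 + 1)).eventually_lt ((ht (i + 1)).const_mul w) (hgw i)),
          eventually_gt_atTop 0] with N hN hN0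
        have hN0' : (0 : ℝ) < N := by exact_mod_cast hN0
        rw [← mul_div_assoc, div_lt_div_iff_of_pos_right hN0'] at hN
        exact hN.le
    filter_upwards [e1, e2, eventually_gt_atTop 0] with N h1 h2 hN0
    have hN0' : (0 : ℝ) < N := by exact_mod_cast hN0
    rw [← mul_div_assoc, div_lt_div_iff_of_pos_right hN0'] at h1
    exact ⟨h1, h2⟩
  have hall : ∀ᶠ N : ℕ in atTop, ∀ i ∈ Finset.range (l + 1),
      ρ * t N i < t N (i + 1) ∧ (t N (i + 1) : ℝ) ≤ w * t N i :=
    (Finset.range (l + 1)).eventually_all.mpr fun i _ => hev i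
  obtain ⟨N, hN, hN0⟩ := (hall.and (eventually_gt_atTop 0)).exists
  refine ⟨t N, fun i hi => hN i (by simp; omega), ?_, ?_, ?_⟩
  · simp only [t, one_ne_zero, if_false, if_true]
    push_cast
    rw [← hw]
    ring
  · simp [t, show l ≠ 0 by omega]
  · simp only [t, show l ≠ 0 by omega, show l ≠ 1 by omega, show l ≠ l + 1 by omega, if_false]
    intro hdvd
    exact hp.one_lt.ne' (Nat.dvd_one.mp ((Nat.dvd_add_right (dvd_mul_right _ _)).mp hdvd))

/-- Consecutive terms are a common multiple of consecutive terms of the first period, so homogeneous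
inequalities carry over. -/
theorem exists_periodic_extension {l Q : ℕ} (hQ : 0 < Q) (t : ℕ → ℕ)
    (ht : t (l + 1) = Q * t 0) :
    ∃ s : ℕ → ℕ, (∀ i ≤ l + 1, s i = t i) ∧ (∀ i, s (i + (l + 1)) = Q * s i) ∧
      ∀ i, ∃ j ≤ l, ∃ e > 0, s i = e * t j ∧ s (i + 1) = e * t (j + 1) := by
  have hmod : ∀ i, i % (l + 1) < l + 1 := fun i => Nat.mod_lt _ (by omega)
  refine ⟨fun i => Q ^ (i / (l + 1)) * t (i % (l + 1)), fun i hi => ?_, fun i => ?_, fun i => ?_⟩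
  · rcases hi.lt_or_eq with h | rfl
    · simp [Nat.div_eq_of_lt h, Nat.mod_eq_of_lt h]
    · simp [ht, Nat.div_self (show 0 < l + 1 by omega)]
  · simp only [Nat.add_mod_right, Nat.add_div_right i (show 0 < l + 1 by omega), pow_succ]
    ring
  · refine ⟨i % (l + 1), Nat.lt_succ_iff.mp (hmod i), Q ^ (i / (l + 1)), by positivity, rfl, ?_⟩
    have hi := Nat.div_add_mod i (l + 1)
    rcases Nat.lt_or_ge (i % (l + 1) + 1) (l + 1) with h | h
    · have h1 : (i + 1) / (l + 1) = i / (l + 1) ∧ (i + 1) % (l + 1) = i % (l + 1) + 1 := by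
        rw [Nat.div_mod_unique (by omega)]
        exact ⟨by omega, h⟩
      simp only [h1.1, h1.2]
    · have h0 : i % (l + 1) = l := by have := hmod i; omega
      have h1 : (i + 1) / (l + 1) = i / (l + 1) + 1 ∧ (i + 1) % (l + 1) = 0 := by
        rw [Nat.div_mod_unique (by omega), mul_add]
        exact ⟨by omega, by omega⟩
      simp only [h1.1, h1.2, h0, ht, pow_succ]
      ring

theorem exists_growth_sequence {p : ℕ} (hp : p.Prime) {ρ : ℝ} {w : ℚ} (hρ : 1 < ρ)
    (hρw : ρ < w) :
    ∀ᶠ k : ℕ in atTop, ∃ (l : ℕ) (s : ℕ → ℕ), (∀ i, ρ * s i < s (i + 1)) ∧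
      (∀ i, (s (i + 1) : ℝ) ≤ w * s i) ∧ (s 1 : ℝ) = w * s 0 ∧
      (∀ i, s (i + (l + 1)) = p ^ k * s i) ∧ ¬ p ∣ s l := by
  have hw1 : (1 : ℝ) < w := hρ.trans hρw
  have hw0 : (0 : ℝ) < w := by linarith
  have hρ0 : 0 < ρ := by linarith
  obtain ⟨L, hL⟩ := pow_unbounded_of_one_lt (w : ℝ) ((one_lt_div hρ0).mpr hρw)
  have hlim : Tendsto (fun k : ℕ => (p : ℝ) ^ k / w) atTop atTop :=
    (tendsto_pow_atTop_atTop_of_one_lt (by exact_mod_cast hp.one_lt)).atTop_div_const hw0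
  filter_upwards [hlim.eventually_ge_atTop ((w : ℝ) ^ (L + 2))] with k hk
  classical
  have hex := pow_unbounded_of_one_lt ((p : ℝ) ^ k / w) hw1
  -- With `l` least such that `w ^ (l + 1) > p ^ k`, the root `r = (p ^ k / w) ^ (1 / l)` is below
  -- `w`; it exceeds `ρ` because `l ≥ L` gives `(w / ρ) ^ l > w`, hence `ρ ^ l < w ^ (l - 1)`.
  set l := Nat.find hex with hl
  have hl1 : (p : ℝ) ^ k / w < (w : ℝ) ^ l := Nat.find_spec hex
  have hLl : L + 2 < l := (pow_lt_pow_iff_right₀ hw1).mp (hk.trans_lt hl1)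
  have hl2 : (w : ℝ) ^ (l - 1) ≤ (p : ℝ) ^ k / w := not_lt.mp (Nat.find_min hex (by omega))
  have hl3 : ρ ^ l < (p : ℝ) ^ k / w := by
    refine lt_of_lt_of_le ?_ hl2
    have h1 : (w : ℝ) < (w / ρ) ^ l := hL.trans_le
      (pow_le_pow_right₀ ((one_lt_div hρ0).mpr hρw).le (by omega))
    rw [div_pow, lt_div_iff₀ (by positivity)] at h1
    have h2 : (w : ℝ) ^ l = w * (w : ℝ) ^ (l - 1) := by
      rw [← pow_succ']
      congr 1
      omega
    rw [h2] at h1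
    exact lt_of_mul_lt_mul_left h1 hw0.le
  have hl0 : (l : ℝ) ≠ 0 := by
    have : l ≠ 0 := by omega
    exact_mod_cast this
  have hQ0 : 0 < (p : ℝ) ^ k / w := lt_trans (by positivity) hl3
  set r : ℝ := ((p : ℝ) ^ k / w) ^ ((l : ℝ)⁻¹) with hr
  have hrl : r ^ l = (p : ℝ) ^ k / w := by
    rw [hr, ← Real.rpow_natCast, ← Real.rpow_mul hQ0.le, inv_mul_cancel₀ hl0, Real.rpow_one]
  have hr0 : 0 ≤ r := Real.rpow_nonneg hQ0.le _
  have hρr : ρ < r := lt_of_pow_lt_pow_left₀ l hr0 (hrl ▸ hl3)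
  have hrw : r < w := lt_of_pow_lt_pow_left₀ l hw0.le (hrl ▸ hl1)
  have hwq : 0 < w := by exact_mod_cast hw0
  have hwb : (w : ℝ) * w.den = (w.num.toNat : ℕ) := by
    have h1 : (w.num.toNat : ℤ) = w.num := Int.toNat_of_nonneg (Rat.num_pos.mpr hwq).le
    have h2 : w * w.den = w.num := Rat.mul_den_eq_num w
    have h3 : ((w.num.toNat : ℕ) : ℝ) = (w.num : ℝ) := by
      exact_mod_cast congrArg (Int.cast (R := ℝ)) h1
    rw [h3]
    exact_mod_cast h2
  have hc0 : 0 < w.num.toNat := by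
    have := Rat.num_pos.mpr hwq
    omega
  obtain ⟨t, ht1, ht3, ht4, ht5⟩ := exists_growth_period hp (l := l) (Q := p ^ k)
    (by omega) w.den_pos hc0 hρ0 hρr hrw hwb (by
      rw [hrl, ← hwb]
      push_cast
      field_simp)
  obtain ⟨s, hs1, hs2, hs3⟩ := exists_periodic_extension (pow_pos hp.pos k) t ht4
  refine ⟨l, s, fun i => ?_, fun i => ?_, ?_, hs2, ?_⟩
  · obtain ⟨j, hj, e, he, h1, h2⟩ := hs3 i
    have he' : (0 : ℝ) < e := by exact_mod_cast he
    rw [h1, h2]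
    push_cast
    have := mul_lt_mul_of_pos_left (ht1 j hj).1 he'
    linarith
  · obtain ⟨j, hj, e, he, h1, h2⟩ := hs3 i
    have he' : (0 : ℝ) < e := by exact_mod_cast he
    rw [h1, h2]
    push_cast
    have := mul_le_mul_of_nonneg_left (ht1 j hj).2 he'.le
    linarith
  · rw [hs1 0 (by omega), hs1 1 (by omega), ht3]
  · rwa [hs1 l (by omega)]

end GrowthSequence

/-! ### From bounds on values to the exponents `w` and `wStar`. -/

section Exponents

variable {F : Type*} [Field F] {a : ℕ → F[X]} {ξ : Series F}

theorem polyEmbClosure_injective : Function.Injective (polyEmbClosure F) :=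
  (algebraMap (Series F) (Closure F)).injective.comp polyEmb_injective

theorem eval₂_polyEmbClosure (P : F[X][X]) (x : Series F) :
    P.eval₂ (polyEmbClosure F) (algebraMap (Series F) (Closure F) x) =
      algebraMap (Series F) (Closure F) (P.eval₂ (polyEmb F : F[X] →+* Series F) x) :=
  (hom_eval₂ P _ _ x).symm

theorem strictMono_natDegree_cfDen (ha : ∀ i, (a i).Monic) (hd : ∀ i, 0 < (a i).natDegree) :
    StrictMono fun n => (cfDen a n).natDegree :=
  strictMono_nat_of_lt_succ fun n => by
    rw [natDegree_cfDen_succ ha hd]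
    have := hd n
    omega

theorem isMinPoly_convergentPoly (ha : ∀ i, (a i).Monic) (hd : ∀ i, 0 < (a i).natDegree) (n : ℕ) :
    IsMinPoly (algebraMap (Series F) (Closure F) (convergent a n)) (convergentPoly a n) := by
  have h0 := monic_cfDen ha hd n
  have h1 := natDegree_convergentPoly ha hd n
  have hprim : (convergentPoly a n).IsPrimitive := by
    intro c hc
    rw [C_dvd_iff_dvd_coeff] at hc
    refine (isCoprime_cfNum_cfDen a n).isUnit_of_dvd' ?_ ?_
    · simpa [convergentPoly] using hc 0
    · simpa [convergentPoly] using hc 1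
  have hirr : Irreducible (convergentPoly a n) := by
    rw [convergentPoly, sub_eq_add_neg, ← C_neg]
    exact irreducible_C_mul_X_add_C h0.ne_zero
      (isCoprime_cfNum_cfDen a n).symm.neg_right.isRelPrime
  refine ⟨by omega, hirr, hprim, ?_, ?_⟩
  · rw [leadingCoeff, h1]
    simpa [convergentPoly] using h0
  · rw [eval₂_polyEmbClosure]
    simp [convergentPoly, convergent, mul_div_cancel₀, polyEmb_ne_zero h0.ne_zero]

theorem not_isRational_of_lower_bound {d : ℕ} (hd : 1 ≤ d)
    (hne : ∀ P : F[X][X], P ≠ 0 → P.natDegree ≤ d →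
      P.eval₂ (polyEmb F : F[X] →+* Series F) ξ ≠ 0) : ¬ IsRational ξ := by
  rintro ⟨A, B, hB, rfl⟩
  have hdeg : (C B * X - C A).natDegree = 1 := by
    rw [natDegree_sub_C, natDegree_C_mul_X _ hB]
  refine hne (C B * X - C A) ?_ (by omega) ?_
  · intro h0
    rw [h0] at hdeg
    simp at hdeg
  · simp [mul_div_cancel₀, polyEmb_ne_zero hB]

variable [Finite F]

/-- An approximation better than the exponent `u` has bounded height, so there are finitely many of
them. -/
theorem le_rpow_inv_of_mul_rpow_le {c H u v : ℝ} (hc : 0 < c) (hH : 1 ≤ H) (huv : u < v)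
    (h : c * H ^ (-u) ≤ H ^ (-v)) : H ≤ (c⁻¹) ^ (v - u)⁻¹ := by
  have hH0 : 0 < H := by linarith
  have h1 : H ^ (v - u) ≤ c⁻¹ := by
    rw [le_inv_comm₀ (by positivity) hc]
    have : c = c * H ^ (-u) * H ^ u := by
      rw [mul_assoc, ← Real.rpow_add hH0]
      simp
    rw [this, ← Real.rpow_neg hH0.le, show -(v - u) = -v + u by ring, Real.rpow_add hH0]
    exact mul_le_mul_of_nonneg_right h (by positivity)
  calc H = (H ^ (v - u)) ^ (v - u)⁻¹ := by
        rw [← Real.rpow_mul hH0.le, mul_inv_cancel₀ (by linarith : v - u ≠ 0), Real.rpow_one]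
    _ ≤ _ := Real.rpow_le_rpow (by positivity) h1 (inv_nonneg.mpr (by linarith))

theorem one_le_height {P : F[X][X]} (hP : P ≠ 0) : 1 ≤ height P := by
  obtain ⟨h, hh⟩ := exists_height_eq_pow hP
  rw [hh]
  exact one_le_pow₀ one_lt_card.le

theorem w_le_of_lower_bound {d n : ℕ} (hn : n ≤ d) {u c : ℝ} (hc : 0 < c)
    (hlow : ∀ P : F[X][X], P ≠ 0 → P.natDegree ≤ d →
      c * height P ^ (-u) ≤ seriesAbs F (P.eval₂ (polyEmb F : F[X] →+* Series F) ξ)) :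
    w n ξ ≤ (u : EReal) := by
  refine sSup_le ?_
  rintro _ ⟨v, rfl, hinf⟩
  rw [EReal.coe_le_coe_iff]
  by_contra! hlt
  refine hinf ((finite_setOf_height_le n ((c⁻¹) ^ (v - u)⁻¹)).subset ?_)
  rintro P ⟨hPn, hpos, hle⟩
  have hP : P ≠ 0 := by
    rintro rfl
    simp at hpos
  exact ⟨hPn, le_rpow_inv_of_mul_rpow_le hc (one_le_height hP) hlt
    ((hlow P hP (hPn.trans hn)).trans hle)⟩

theorem closureAbsVal_polyEmbClosure (A : F[X]) :
    closureAbsVal F (polyEmbClosure F A) = polyAbs F A :=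
  closureAbsVal_algebraMap _

/-- A good approximation `α` lies in the unit disc, where `|P(ξ)| = |P(ξ) - P(α)| ≤ H(P) |ξ - α|`.
So `α` is a root of one of finitely many polynomials. -/
theorem wStar_le_of_lower_bound {d n : ℕ} (hn : n ≤ d) {u c : ℝ} (hu : 0 ≤ u) (hc : 0 < c)
    (hξ : seriesAbs F ξ ≤ 1)
    (hlow : ∀ P : F[X][X], P ≠ 0 → P.natDegree ≤ d →
      c * height P ^ (-u) ≤ seriesAbs F (P.eval₂ (polyEmb F : F[X] →+* Series F) ξ)) :
    wStar n ξ ≤ (u : EReal) := by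
  classical
  refine sSup_le ?_
  rintro _ ⟨v, rfl, hinf⟩
  rw [EReal.coe_le_coe_iff]
  by_contra! hlt
  refine hinf (((finite_setOf_height_le n ((c⁻¹) ^ (v - u)⁻¹)).biUnion fun P _ =>
    ((P.map (polyEmbClosure F)).roots.toFinset.finite_toSet)).subset ?_)
  rintro α ⟨P, ⟨hdeg, -, -, -, hroot⟩, hPn, -, hle⟩
  have hP : P ≠ 0 := by
    rintro rfl
    simp at hdeg
  have hH := one_le_height hP
  have hH0 : 0 < height P := by linarith
  change closureAbsVal F _ ≤ _ at hle
  have hξ' : closureAbsVal F (algebraMap (Series F) (Closure F) ξ) ≤ 1 := by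
    rwa [closureAbsVal_algebraMap]
  have hα : closureAbsVal F α ≤ 1 := by
    have h1 : closureAbsVal F (α - algebraMap (Series F) (Closure F) ξ) ≤ 1 := by
      rw [(closureAbsVal F).map_sub]
      exact hle.trans (Real.rpow_le_one_of_one_le_of_nonpos hH (by linarith))
    have := isNonarchimedean_closureAbsVal (α - algebraMap (Series F) (Closure F) ξ)
      (algebraMap (Series F) (Closure F) ξ)
    rw [sub_add_cancel] at this
    exact this.trans (max_le h1 hξ')
  have hPξ := abs_eval₂_sub_le (closureAbsVal F) isNonarchimedean_closureAbsVal
    (polyEmbClosure F) closureAbsVal_polyEmbClosure P hξ' hα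
  rw [hroot, sub_zero, eval₂_polyEmbClosure, closureAbsVal_algebraMap] at hPξ
  have hPv : seriesAbs F (P.eval₂ (polyEmb F : F[X] →+* Series F) ξ) ≤ height P ^ (-v) := by
    refine (hPξ.trans (mul_le_mul_of_nonneg_left hle hH0.le)).trans (le_of_eq ?_)
    rw [mul_comm, ← Real.rpow_add_one hH0.ne']
    congr 1
    ring
  simp only [Set.mem_iUnion]
  refine ⟨P, ⟨hPn, le_rpow_inv_of_mul_rpow_le hc hH hlt
    ((hlow P hP (hPn.trans hn)).trans hPv)⟩, ?_⟩
  rw [Finset.mem_coe, Multiset.mem_toFinset, mem_roots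
    ((Polynomial.map_ne_zero_iff polyEmbClosure_injective).mpr hP), IsRoot.def, eval_map, hroot]

theorem IsCfLimit.le_w (ha : ∀ i, (a i).Monic) (hd : ∀ i, 0 < (a i).natDegree)
    (hξ : IsCfLimit a ξ) {n : ℕ} (hn : 1 ≤ n) {u : ℝ}
    (hinf : {k | u * (cfDen a k).natDegree ≤ (cfDen a (k + 1)).natDegree}.Infinite) :
    (u : EReal) ≤ w n ξ := by
  refine le_sSup ⟨u, rfl, (hinf.image (f := convergentPoly a) ?_).mono ?_⟩
  · intro i _ j _ hij
    refine (strictMono_natDegree_cfDen ha hd).injective ?_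
    have := congrArg (fun P => P.coeff 1) hij
    simp only [convergentPoly, coeff_sub, coeff_C_mul, coeff_X_one, mul_one, coeff_C_succ,
      sub_zero] at this
    simp only [this]
  · rintro _ ⟨k, hk, rfl⟩
    have hk' : u * (cfDen a k).natDegree ≤ (cfDen a (k + 1)).natDegree := hk
    refine ⟨(natDegree_convergentPoly ha hd k).trans_le hn, ?_, ?_⟩
    · rw [hξ.seriesAbs_convergentPoly ha hd]
      exact zpow_pos card_pos _
    · rw [hξ.seriesAbs_convergentPoly ha hd, height_convergentPoly ha hd, ← Real.rpow_natCast,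
        ← Real.rpow_mul card_pos.le, ← Real.rpow_intCast]
      refine Real.rpow_le_rpow_of_exponent_le one_lt_card.le ?_
      push_cast
      linarith

theorem IsCfLimit.le_wStar (ha : ∀ i, (a i).Monic) (hd : ∀ i, 0 < (a i).natDegree)
    (hξ : IsCfLimit a ξ) {n : ℕ} (hn : 1 ≤ n) {u : ℝ}
    (hinf : {k | u * (cfDen a k).natDegree ≤ (cfDen a (k + 1)).natDegree}.Infinite) :
    (u : EReal) ≤ wStar n ξ := by
  have hmono := strictMono_natDegree_cfDen ha hd
  refine le_sSup ⟨u, rfl, (hinf.image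
    (f := fun k => algebraMap (Series F) (Closure F) (convergent a k)) ?_).mono ?_⟩
  -- Distinct convergents are told apart by their distances to `ξ`, which strictly decrease.
  · intro i _ j _ hij
    have h1 : convergent a i = convergent a j := (algebraMap (Series F) (Closure F)).injective hij
    have h2 := hξ i
    rw [h1, hξ j, zpow_right_inj₀ card_pos one_lt_card.ne'] at h2
    by_contra hne
    rcases Nat.lt_or_gt_of_ne hne with h | h
    · have h3 : (cfDen a i).natDegree < (cfDen a j).natDegree := hmono h
      have h4 : (cfDen a (i + 1)).natDegree < (cfDen a (j + 1)).natDegree := hmono (by omega)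
      omega
    · have h3 : (cfDen a j).natDegree < (cfDen a i).natDegree := hmono h
      have h4 : (cfDen a (j + 1)).natDegree < (cfDen a (i + 1)).natDegree := hmono (by omega)
      omega
  · rintro _ ⟨k, hk, rfl⟩
    have hk' : u * (cfDen a k).natDegree ≤ (cfDen a (k + 1)).natDegree := hk
    refine ⟨convergentPoly a k, isMinPoly_convergentPoly ha hd k,
      (natDegree_convergentPoly ha hd k).trans_le hn, ?_, ?_⟩
    · rw [← map_sub, closureAbs_algebraMap, hξ k]
      exact zpow_pos card_pos _
    · rw [← map_sub, closureAbs_algebraMap, hξ k, height_convergentPoly ha hd,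
        ← Real.rpow_natCast, ← Real.rpow_mul card_pos.le, ← Real.rpow_intCast]
      refine Real.rpow_le_rpow_of_exponent_le one_lt_card.le ?_
      push_cast
      linarith

end Exponents

/-! ### The equation between `ξ` and `ξ ^ (p ^ k)`; Class IA. -/

section FunctionalEquation

variable {F : Type*} [Field F] {a : ℕ → F[X]} {ξ : Series F} {p k l : ℕ}

/-- The polynomial with coefficients in `F[T]` that vanishes at `[0; a 0, a 1, …]` when
`a (i + (l + 1)) = a i ^ Q` for all `i`. -/
noncomputable def periodPoly (a : ℕ → F[X]) (l Q : ℕ) : F[X][X] :=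
  C (cfDen a l) * X ^ (Q + 1) - C (cfNum a l) * X ^ Q + C (cfDen a (l + 1)) * X -
    C (cfNum a (l + 1))

theorem eval₂_periodPoly {L : Type*} [CommRing L] (i : F[X] →+* L) (x : L) (Q : ℕ) :
    (periodPoly a l Q).eval₂ i x = x * (i (cfDen a (l + 1)) + x ^ Q * i (cfDen a l)) -
      (i (cfNum a (l + 1)) + x ^ Q * i (cfNum a l)) := by
  simp [periodPoly, eval₂_sub, eval₂_add, eval₂_mul]
  ring

/-- Frobenius is a ring homomorphism, so the convergents of the shifted fraction are the `p ^ k`-th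
powers of the original ones. -/
theorem eval₂_periodPoly_convergent [Fact p.Prime] [CharP F p] (ha : ∀ i, (a i).Monic)
    (hd : ∀ i, 0 < (a i).natDegree) (hper : ∀ i, a (i + (l + 1)) = a i ^ p ^ k) (n : ℕ) :
    convergent a (n + (l + 1)) * (polyEmb F (cfDen a (l + 1)) +
      convergent a n ^ p ^ k * polyEmb F (cfDen a l)) =
      polyEmb F (cfNum a (l + 1)) + convergent a n ^ p ^ k * polyEmb F (cfNum a l) := by
  have hfrob : (fun i => a (i + (l + 1))) = fun i => iterateFrobenius F[X] p k (a i) :=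
    funext fun i => by rw [hper, iterateFrobenius_def]
  have hn := cfNum_add a l n
  have hm := cfDen_add a l n
  rw [hfrob, cfNum_map, cfDen_map, iterateFrobenius_def, iterateFrobenius_def] at hn hm
  have h0 := polyEmb_ne_zero (monic_cfDen ha hd n).ne_zero
  have h1 := polyEmb_ne_zero (monic_cfDen ha hd (n + (l + 1))).ne_zero
  have h2 := congrArg (polyEmb F) hn
  have h3 := congrArg (polyEmb F) hm
  simp only [map_add, map_mul, map_pow] at h2 h3
  rw [convergent, convergent, div_pow]
  field_simp
  linear_combination (-polyEmb F (cfNum a (n + (l + 1)))) * h3 +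
    (polyEmb F (cfDen a (n + (l + 1)))) * h2

theorem natDegree_periodPoly (ha : ∀ i, (a i).Monic) (hd : ∀ i, 0 < (a i).natDegree) {Q : ℕ}
    (hQ : 1 < Q) : (periodPoly a l Q).natDegree = Q + 1 := by
  have h0 := (monic_cfDen ha hd l).ne_zero
  refine natDegree_eq_of_le_of_coeff_ne_zero ?_ ?_
  · rw [periodPoly]
    compute_degree!
  · have : Q ≠ 0 := by omega
    simpa [periodPoly, coeff_X, coeff_C, this, hQ.ne', coeff_X_pow] using h0

variable [Finite F]

theorem IsCfLimit.eval₂_periodPoly_eq_zero [Fact p.Prime] [CharP F p] (ha : ∀ i, (a i).Monic)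
    (hd : ∀ i, 0 < (a i).natDegree) (hξ : IsCfLimit a ξ)
    (hper : ∀ i, a (i + (l + 1)) = a i ^ p ^ k) :
    (periodPoly a l (p ^ k)).eval₂ (polyEmb F : F[X] →+* Series F) ξ = 0 := by
  set P := periodPoly a l (p ^ k)
  set V := seriesAbs F
  have hV : IsNonarchimedean V := isNonarchimedean_seriesAbs
  have hξ1 := (hξ.seriesAbs_lt_one hd).le
  have hH : ∀ i, V (polyEmb F (cfDen a i)) ≤ (Nat.card F : ℝ) ^ (cfDen a i).natDegree :=
    fun i => (seriesAbs_polyEmb (monic_cfDen ha hd i).ne_zero).le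
  have hdist : ∀ n, V (ξ - convergent a n) ≤ ((Nat.card F : ℝ)⁻¹) ^ n := by
    intro n
    rw [hξ n, inv_pow, ← zpow_natCast, ← zpow_neg]
    refine zpow_le_zpow_right₀ one_lt_card.le ?_
    have := le_natDegree_cfDen ha hd n
    omega
  have hinv : (Nat.card F : ℝ)⁻¹ < 1 := inv_lt_one_of_one_lt₀ one_lt_card
  by_contra hne
  obtain ⟨h, hh⟩ : ∃ h : ℝ, 0 < h ∧ ∀ n, V (P.eval₂ (polyEmb F : F[X] →+* Series F) ξ) ≤
      h * ((Nat.card F : ℝ)⁻¹) ^ n := by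
    refine ⟨max (V (polyEmb F (cfDen a (l + 1)))) (V (polyEmb F (cfDen a l))) +
      V (ξ * polyEmb F (cfDen a l) - polyEmb F (cfNum a l)), ?_, fun n => ?_⟩
    · refine add_pos_of_pos_of_nonneg (lt_max_of_lt_left (V.pos ?_)) (V.nonneg _)
      exact polyEmb_ne_zero (monic_cfDen ha hd _).ne_zero
    have hx := seriesAbs_convergent_le_one ha hd n
    -- Subtracting the relation between the convergents of index `n` and `n + (l + 1)` leaves only
    -- differences that tend to `0`.
    have e : P.eval₂ (polyEmb F : F[X] →+* Series F) ξ =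
        (ξ - convergent a (n + (l + 1))) * (polyEmb F (cfDen a (l + 1)) +
          convergent a n ^ p ^ k * polyEmb F (cfDen a l)) +
        (ξ ^ p ^ k - convergent a n ^ p ^ k) *
          (ξ * polyEmb F (cfDen a l) - polyEmb F (cfNum a l)) := by
      rw [eval₂_periodPoly]
      simp only [RingHom.coe_coe]
      linear_combination eval₂_periodPoly_convergent ha hd hper n
    rw [e, add_mul]
    refine (V.add_le _ _).trans (add_le_add ?_ ?_)
    · rw [map_mul, mul_comm]
      refine mul_le_mul ((hV _ _).trans (max_le_max le_rfl ?_)) ((hdist _).trans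
        (pow_le_pow_of_le_one (by positivity) hinv.le (by omega))) (V.nonneg _)
        (le_max_of_le_left (V.nonneg _))
      rw [map_mul, map_pow]
      exact mul_le_of_le_one_left (V.nonneg _) (pow_le_one₀ (V.nonneg _) hx)
    · rw [map_mul, mul_comm]
      exact mul_le_mul_of_nonneg_left ((abs_pow_sub_pow_le V hV hξ1 hx _).trans (hdist n))
        (V.nonneg _)
  obtain ⟨n, hn⟩ := exists_pow_lt_of_lt_one (div_pos (V.pos hne) hh.1) hinv
  rw [lt_div_iff₀ hh.1, mul_comm] at hn
  exact absurd (hh.2 n) (not_le.mpr hn)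

/-- The denominator of the homographic map has constant absolute value on the unit disc, because
`cfDen a (l + 1)` dominates. -/
theorem abs_den_add_eq {L : Type*} [Field L] (v : AbsoluteValue L ℝ) (hv : IsNonarchimedean v)
    (i : F[X] →+* L) (hi : ∀ c, v (i c) = polyAbs F c) (ha : ∀ i, (a i).Monic)
    (hd : ∀ i, 0 < (a i).natDegree) {x : L} (hx : v x ≤ 1) (Q : ℕ) :
    v (i (cfDen a (l + 1)) + x ^ Q * i (cfDen a l)) =
      (Nat.card F : ℝ) ^ (cfDen a (l + 1)).natDegree := by
  have h1 : v (i (cfDen a (l + 1))) = (Nat.card F : ℝ) ^ (cfDen a (l + 1)).natDegree := by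
    rw [hi, polyAbs_apply, seriesAbs_polyEmb (monic_cfDen ha hd _).ne_zero]
  rw [← h1]
  refine hv.add_eq_left_of_lt ?_
  rw [map_mul, map_pow]
  refine (mul_le_of_le_one_left (v.nonneg _) (pow_le_one₀ (v.nonneg _) hx)).trans_lt ?_
  rw [h1, hi, polyAbs_apply, seriesAbs_polyEmb (monic_cfDen ha hd _).ne_zero]
  exact pow_lt_pow_right₀ one_lt_card (strictMono_natDegree_cfDen ha hd (Nat.lt_succ_self l))

theorem IsCfLimit.isClassIA [Fact p.Prime] [CharP F p] (ha : ∀ i, (a i).Monic)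
    (hd : ∀ i, 0 < (a i).natDegree) (hξ : IsCfLimit a ξ) (hk : 0 < k)
    (hper : ∀ i, a (i + (l + 1)) = a i ^ p ^ k) (hrat : ¬ IsRational ξ) : IsClassIA p ξ := by
  refine ⟨hrat, k, cfNum a l, cfNum a (l + 1), cfDen a l, cfDen a (l + 1), ⟨-(-1) ^ l, ?_, ?_⟩,
    fun h => absurd h hk.ne', ?_⟩
  · simp
  · have := cfNum_mul_cfDen_sub a l
    rw [C_neg, C_pow, C_neg, C_1, ← this]
    ring
  · have h0 := hξ.eval₂_periodPoly_eq_zero ha hd hper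
    rw [eval₂_periodPoly, sub_eq_zero] at h0
    simp only [RingHom.coe_coe] at h0
    have h1 := abs_den_add_eq (l := l) (seriesAbs F) isNonarchimedean_seriesAbs
      (polyEmb F : F[X] →+* Series F) (fun _ => rfl) ha hd (hξ.seriesAbs_lt_one hd).le (p ^ k)
    simp only [RingHom.coe_coe] at h1
    have h2 : polyEmb F (cfDen a (l + 1)) + ξ ^ p ^ k * polyEmb F (cfDen a l) ≠ 0 := by
      refine (AbsoluteValue.ne_zero_iff (seriesAbs F)).mp ?_
      rw [h1]
      exact (pow_pos card_pos _).ne'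
    rw [eq_div_iff (by rw [add_comm, mul_comm]; exact h2)]
    linear_combination h0

end FunctionalEquation

/-! ### Irreducibility of `periodPoly` and the degree of `ξ`. -/

section Degree

variable {F : Type*} [Field F] {a : ℕ → F[X]} {ξ : Series F} {p k l : ℕ}

theorem isPrimitive_periodPoly {Q : ℕ} (hQ : 1 < Q) : (periodPoly a l Q).IsPrimitive := by
  intro c hc
  rw [C_dvd_iff_dvd_coeff] at hc
  have hQ0 : Q ≠ 0 := by omega
  refine (isCoprime_cfNum_cfDen a l).isUnit_of_dvd' ?_ ?_
  · have := hc Q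
    simpa [periodPoly, coeff_X, coeff_C, hQ0, hQ.ne, hQ.ne', coeff_X_pow] using this
  · have := hc (Q + 1)
    simpa [periodPoly, coeff_X, coeff_C, hQ0, coeff_X_pow] using this

variable [Finite F]

/-- The unit disc contains at most one root, as the homographic map composed with the `Q`-th power
contracts it. Outside, comparing leading terms determines the absolute value. -/
theorem abs_root_periodPoly {L : Type*} [Field L] (v : AbsoluteValue L ℝ) (hv : IsNonarchimedean v)
    (i : F[X] →+* L) (hi : ∀ c, v (i c) = polyAbs F c) (ha : ∀ i, (a i).Monic)
    (hd : ∀ i, 0 < (a i).natDegree) {Q : ℕ} {x y : L} (hxy : x ≠ y) (hy : v y ≤ 1)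
    (hx0 : (periodPoly a l Q).eval₂ i x = 0) (hy0 : (periodPoly a l Q).eval₂ i y = 0) :
    v x ^ Q = (Nat.card F : ℝ) ^ (a l).natDegree := by
  have hD : ∀ j, v (i (cfDen a j)) = (Nat.card F : ℝ) ^ (cfDen a j).natDegree := fun j => by
    rw [hi, polyAbs_apply, seriesAbs_polyEmb (monic_cfDen ha hd j).ne_zero]
  have hN : ∀ j, v (i (cfNum a j)) ≤ v (i (cfDen a j)) := fun j => by
    rw [hD, hi, polyAbs_apply]
    by_cases h : cfNum a j = 0
    · simp [h]
    · rw [seriesAbs_polyEmb h]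
      exact pow_le_pow_right₀ one_lt_card.le (natDegree_cfNum_le ha hd j)
  have hDpos : ∀ j, 0 < v (i (cfDen a j)) := fun j => by
    rw [hD]
    exact pow_pos card_pos _
  rw [eval₂_periodPoly] at hx0 hy0
  rcases le_or_gt (v x) 1 with hx | hx
  · exfalso
    have hNx := abs_den_add_eq (l := l) v hv i hi ha hd hx Q
    have hNy := abs_den_add_eq (l := l) v hv i hi ha hd hy Q
    have hdet := congrArg i (cfNum_mul_cfDen_sub a l)
    simp only [map_sub, map_mul, map_pow, map_neg, map_one] at hdet
    -- The difference of two homographic images: determinant `±1`, over a product of denominators of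
    -- absolute value greater than `1`.
    have key : (x - y) * ((i (cfDen a (l + 1)) + x ^ Q * i (cfDen a l)) *
        (i (cfDen a (l + 1)) + y ^ Q * i (cfDen a l))) = -(-1) ^ l * (x ^ Q - y ^ Q) := by
      rw [← hdet]
      linear_combination (i (cfDen a (l + 1)) + y ^ Q * i (cfDen a l)) * hx0 -
        (i (cfDen a (l + 1)) + x ^ Q * i (cfDen a l)) * hy0
    have habs := congrArg v key
    rw [map_mul, map_mul, hNx, hNy, map_mul, v.map_neg, map_pow, v.map_neg, v.map_one, one_pow,
      one_mul] at habs
    have hpos : 0 < v (x - y) := v.pos (sub_ne_zero.mpr hxy)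
    have hle := abs_pow_sub_pow_le v hv hx hy Q
    rw [← habs] at hle
    have h1 : (1 : ℝ) < (Nat.card F : ℝ) ^ (cfDen a (l + 1)).natDegree := by
      have := le_natDegree_cfDen ha hd (l + 1)
      exact one_lt_pow₀ one_lt_card (by omega)
    have h2 : 1 < (Nat.card F : ℝ) ^ (cfDen a (l + 1)).natDegree *
        (Nat.card F : ℝ) ^ (cfDen a (l + 1)).natDegree := by nlinarith
    nlinarith
  -- For `|x| > 1` both linear factors have the size of their terms in `x`, so `|x| ^ Q` is the
  -- ratio of two consecutive denominators.
  · have hrel : x ^ Q * (i (cfDen a l) * x + -i (cfNum a l)) =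
        -(i (cfDen a (l + 1)) * x + -i (cfNum a (l + 1))) := by
      linear_combination hx0
    have hlin : ∀ j, v (i (cfDen a j) * x + -i (cfNum a j)) = v (i (cfDen a j)) * v x := by
      intro j
      rw [← map_mul]
      refine hv.add_eq_left_of_lt ?_
      rw [v.map_neg, map_mul]
      exact (hN j).trans_lt (lt_mul_of_one_lt_right (hDpos j) hx)
    have habs := congrArg v hrel
    rw [map_mul, v.map_neg, hlin, hlin, ← mul_assoc, map_pow] at habs
    have h1 := mul_right_cancel₀ (by linarith : v x ≠ 0) habs
    rw [hD, hD, natDegree_cfDen_succ ha hd, pow_add] at h1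
    exact mul_right_cancel₀ (pow_pos card_pos _).ne' h1

/-- So `ξ` is a simple root: in characteristic `p` the derivative is the denominator of the
homographic map, which does not vanish at `ξ`. -/
theorem IsCfLimit.not_eval₂_derivative_periodPoly_eq_zero [Fact p.Prime] [CharP F p]
    (ha : ∀ i, (a i).Monic) (hd : ∀ i, 0 < (a i).natDegree) (hξ : IsCfLimit a ξ) (hk : 0 < k) :
    (derivative (periodPoly a l (p ^ k))).eval₂ (polyEmb F : F[X] →+* Series F) ξ ≠ 0 := by
  have hder : derivative (periodPoly a l (p ^ k)) =
      C (cfDen a l) * X ^ p ^ k + C (cfDen a (l + 1)) := by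
    simp [periodPoly, derivative_X_pow, zero_pow hk.ne']
  have h := abs_den_add_eq (l := l) (seriesAbs F) isNonarchimedean_seriesAbs
    (polyEmb F : F[X] →+* Series F) (fun _ => rfl) ha hd (hξ.seriesAbs_lt_one hd).le (p ^ k)
  rw [hder]
  intro h0
  simp only [eval₂_add, eval₂_mul, eval₂_C, eval₂_X_pow] at h0
  rw [add_comm, mul_comm, h0, map_zero] at h
  exact (pow_pos card_pos _).ne h

/-- The product of the roots is, up to sign, a quotient of two elements of `F[T]`, so its absolute
value is an integral power of `q`. Hence `Q` divides `e * deg g`. -/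
theorem dvd_natDegree_of_roots_pow_eq {g : F[X][X]} (hg : g ≠ 0) {Q e : ℕ} (hQ : 0 < Q)
    (hQe : Q.Coprime e)
    (hroots : ∀ x : Closure F, g.eval₂ (polyEmbClosure F) x = 0 →
      closureAbsVal F x ^ Q = (Nat.card F : ℝ) ^ e) : Q ∣ g.natDegree := by
  set G := g.map (polyEmbClosure F)
  have hG : G ≠ 0 := (Polynomial.map_ne_zero_iff polyEmbClosure_injective).mpr hg
  have hdeg : G.natDegree = g.natDegree := natDegree_map_eq_of_injective polyEmbClosure_injective g
  have hsplit : G.Splits := IsAlgClosed.splits G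
  have hprod := congrArg (closureAbsVal F) (hsplit.eval_eq_prod_roots 0)
  rw [← coeff_zero_eq_eval_zero, map_mul, map_multiset_prod, Multiset.map_map] at hprod
  have hpow : ((G.roots.map (fun x => closureAbsVal F (0 - x))).prod) ^ Q =
      (Nat.card F : ℝ) ^ (e * g.natDegree) := by
    rw [← Multiset.prod_map_pow]
    have : G.roots.map (fun x => closureAbsVal F (0 - x) ^ Q) =
        G.roots.map (fun _ => (Nat.card F : ℝ) ^ e) := by
      refine Multiset.map_congr rfl fun x hx => ?_
      rw [zero_sub, (closureAbsVal F).map_neg]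
      refine hroots x ?_
      rw [mem_roots hG, IsRoot.def, eval_map] at hx
      exact hx
    rw [this, Multiset.map_const', Multiset.prod_replicate, ← hsplit.natDegree_eq_card_roots, hdeg,
      pow_mul]
  have hlead : closureAbsVal F G.leadingCoeff = (Nat.card F : ℝ) ^ g.leadingCoeff.natDegree := by
    rw [leadingCoeff_map_of_injective polyEmbClosure_injective, closureAbsVal_polyEmbClosure,
      polyAbs_apply, seriesAbs_polyEmb (leadingCoeff_ne_zero.mpr hg)]
  have hQpow := congrArg (· ^ Q) hprod
  simp only [mul_pow, Function.comp_def] at hQpow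
  rw [hpow, hlead, coeff_map, closureAbsVal_polyEmbClosure] at hQpow
  have hg0 : g.coeff 0 ≠ 0 := by
    intro h0
    rw [h0, map_zero, zero_pow hQ.ne'] at hQpow
    have : (0 : ℝ) < Nat.card F := card_pos
    exact absurd hQpow (by positivity)
  rw [polyAbs_apply, seriesAbs_polyEmb hg0, ← pow_mul, ← pow_mul, ← pow_add,
    pow_right_inj₀ card_pos one_lt_card.ne'] at hQpow
  have hdvd : Q ∣ e * g.natDegree := by
    rw [← Nat.dvd_add_right (Dvd.intro_left g.leadingCoeff.natDegree rfl), ← hQpow]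
    exact Dvd.intro_left _ rfl
  exact hQe.dvd_of_dvd_mul_left hdvd

theorem IsCfLimit.false_of_periodPoly_eq_mul [Fact p.Prime] [CharP F p] (ha : ∀ i, (a i).Monic)
    (hd : ∀ i, 0 < (a i).natDegree) (hξ : IsCfLimit a ξ) (hk : 0 < k)
    (hper : ∀ i, a (i + (l + 1)) = a i ^ p ^ k) (hp : ¬ p ∣ (a l).natDegree)
    (hrat : ∀ P : F[X][X], P ≠ 0 → P.natDegree ≤ 1 →
      P.eval₂ (polyEmb F : F[X] →+* Series F) ξ ≠ 0)
    {f g : F[X][X]} (hfg : periodPoly a l (p ^ k) = f * g) (hg : 0 < g.natDegree)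
    (hf : f.eval₂ (polyEmb F : F[X] →+* Series F) ξ = 0) : False := by
  have hpp : p.Prime := Fact.out
  have hQ1 : 1 < p ^ k := Nat.one_lt_pow hk.ne' hpp.one_lt
  have hnd := natDegree_periodPoly (l := l) ha hd hQ1
  have hne : f * g ≠ 0 := by
    rw [← hfg]
    rintro h0
    rw [h0, natDegree_zero] at hnd
    omega
  have hf0 := left_ne_zero_of_mul hne
  have hg0 := right_ne_zero_of_mul hne
  have hf2 : 1 < f.natDegree := by
    by_contra! h
    exact hrat f hf0 h hf
  rw [hfg, natDegree_mul hf0 hg0] at hnd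
  -- Otherwise `ξ` would be a double root.
  have hgξ : g.eval₂ (polyEmb F : F[X] →+* Series F) ξ ≠ 0 := by
    intro h0
    refine hξ.not_eval₂_derivative_periodPoly_eq_zero (l := l) (p := p) ha hd hk ?_
    rw [hfg, derivative_mul, eval₂_add, eval₂_mul, eval₂_mul, hf, h0]
    simp
  have hdvd : p ^ k ∣ g.natDegree := by
    refine dvd_natDegree_of_roots_pow_eq (e := (a l).natDegree) hg0 (by omega)
      (Nat.Coprime.pow_left k ((Nat.Prime.coprime_iff_not_dvd hpp).mpr hp)) fun x hx => ?_
    refine abs_root_periodPoly (y := algebraMap (Series F) (Closure F) ξ) (closureAbsVal F)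
      isNonarchimedean_closureAbsVal (polyEmbClosure F) closureAbsVal_polyEmbClosure ha hd ?_ ?_
      ?_ ?_
    · rintro rfl
      rw [eval₂_polyEmbClosure, map_eq_zero] at hx
      exact hgξ hx
    · rw [closureAbsVal_algebraMap]
      exact (hξ.seriesAbs_lt_one hd).le
    · rw [hfg, eval₂_mul, hx, mul_zero]
    · rw [eval₂_polyEmbClosure, hξ.eval₂_periodPoly_eq_zero ha hd hper, map_zero]
  have := Nat.le_of_dvd hg hdvd
  omega

theorem IsCfLimit.isAlgebraicOfDegree [Fact p.Prime] [CharP F p] (ha : ∀ i, (a i).Monic)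
    (hd : ∀ i, 0 < (a i).natDegree) (hξ : IsCfLimit a ξ) (hk : 0 < k)
    (hper : ∀ i, a (i + (l + 1)) = a i ^ p ^ k) (hp : ¬ p ∣ (a l).natDegree)
    (hrat : ∀ P : F[X][X], P ≠ 0 → P.natDegree ≤ 1 →
      P.eval₂ (polyEmb F : F[X] →+* Series F) ξ ≠ 0) :
    IsAlgebraicOfDegree ξ (p ^ k + 1) := by
  have hpp : p.Prime := Fact.out
  have hQ1 : 1 < p ^ k := Nat.one_lt_pow hk.ne' hpp.one_lt
  have hnd := natDegree_periodPoly (l := l) ha hd hQ1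
  have hprim := isPrimitive_periodPoly (a := a) (l := l) hQ1
  have hroot := hξ.eval₂_periodPoly_eq_zero ha hd hper
  refine ⟨periodPoly a l (p ^ k), ⟨by omega, ⟨?_, ?_⟩, hprim, ?_, ?_⟩, hnd⟩
  · intro hu
    have := natDegree_eq_zero_of_isUnit hu
    omega
  · intro f g hfg
    by_cases hf : f.natDegree = 0
    · left
      rw [eq_C_of_natDegree_eq_zero hf] at hfg ⊢
      exact isUnit_C.mpr (hprim _ (Dvd.intro _ hfg.symm))
    by_cases hg : g.natDegree = 0
    · right
      rw [eq_C_of_natDegree_eq_zero hg] at hfg ⊢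
      exact isUnit_C.mpr (hprim _ (Dvd.intro_left _ hfg.symm))
    exfalso
    rw [hfg, eval₂_mul, mul_eq_zero] at hroot
    rcases hroot with h | h
    · exact hξ.false_of_periodPoly_eq_mul ha hd hk hper hp hrat hfg (by omega) h
    · exact hξ.false_of_periodPoly_eq_mul ha hd hk hper hp hrat (hfg.trans (mul_comm f g))
        (by omega) h
  · rw [leadingCoeff, hnd]
    have h0 : p ^ k ≠ 0 := by omega
    simpa [periodPoly, coeff_X, coeff_C, h0, hpp.ne_zero, coeff_X_pow] using monic_cfDen ha hd l
  · rw [eval₂_polyEmbClosure, hroot, map_zero]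

end Degree

/-! ### Partial quotients with prescribed degrees, and the conclusion. -/

section Construction

variable {F : Type*} [Field F]

/-- The partial quotients whose convergents have denominators of degree `s n - s 0`. -/
noncomputable def partialQuotient (F : Type*) [Field F] (s : ℕ → ℕ) (i : ℕ) : F[X] :=
  X ^ (s (i + 1) - s i)

theorem monic_partialQuotient (s : ℕ → ℕ) (i : ℕ) : (partialQuotient F s i).Monic :=
  monic_X_pow _

theorem natDegree_partialQuotient (s : ℕ → ℕ) (i : ℕ) :
    (partialQuotient F s i).natDegree = s (i + 1) - s i := natDegree_X_pow _

theorem natDegree_partialQuotient_pos {s : ℕ → ℕ} (hs : StrictMono s) (i : ℕ) :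
    0 < (partialQuotient F s i).natDegree := by
  rw [natDegree_partialQuotient]
  have := hs (Nat.lt_add_one i)
  omega

theorem natDegree_cfDen_partialQuotient {s : ℕ → ℕ} (hs : StrictMono s) (n : ℕ) :
    (cfDen (partialQuotient F s) n).natDegree + s 0 = s n := by
  induction n with
  | zero => simp [cfDen]
  | succ n ih =>
    rw [natDegree_cfDen_succ (monic_partialQuotient s) (natDegree_partialQuotient_pos hs),
      natDegree_partialQuotient]
    have := hs (Nat.lt_add_one n)
    omega

theorem partialQuotient_add {s : ℕ → ℕ} {m Q : ℕ} (hper : ∀ i, s (i + m) = Q * s i) (i : ℕ) :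
    partialQuotient F s (i + m) = partialQuotient F s i ^ Q := by
  rw [partialQuotient, partialQuotient, ← pow_mul, add_right_comm, hper, hper, ← Nat.mul_sub,
    mul_comm]

/-- The denominators have degrees `s n - s 0` rather than `s n`; the additive constant `K = u * s 0`
absorbs the shift. -/
theorem exists_lower_bound_of_growth [Finite F] {s : ℕ → ℕ} (hs : StrictMono s) {ξ : Series F}
    (hξ : IsCfLimit (partialQuotient F s) ξ) {d : ℕ} {u ρ : ℝ} (hdu : d ≤ u)
    (hd : 1 ≤ d) (hρd : d - 1 < ρ) (hρu : u * (d - 1) ≤ (u - d) * ρ)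
    (hsρ : ∀ i, ρ * s i ≤ s (i + 1)) (hsu : ∀ i, (s (i + 1) : ℝ) ≤ u * s i) :
    ∃ c > 0, ∀ P : F[X][X], P ≠ 0 → P.natDegree ≤ d →
      c * height P ^ (-u) ≤ seriesAbs F (P.eval₂ (polyEmb F : F[X] →+* Series F) ξ) := by
  have hd1 : (1 : ℝ) ≤ d := by exact_mod_cast hd
  have hu : 0 ≤ u := by linarith
  have hs0 : (0 : ℝ) ≤ s 0 := Nat.cast_nonneg _
  have hy : ∀ n, ((cfDen (partialQuotient F s) n).natDegree : ℝ) = s n - s 0 := fun n => by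
    rw [← natDegree_cfDen_partialQuotient (F := F) hs n]
    push_cast
    ring
  have hK : 0 ≤ u * s 0 := mul_nonneg hu hs0
  refine ⟨(Nat.card F : ℝ) ^ (-(u * s 0 * (d + 1))), Real.rpow_pos_of_pos card_pos _,
    fun P hP hPd => hξ.le_seriesAbs_eval₂ (monic_partialQuotient s)
      (natDegree_partialQuotient_pos hs) hu hK ?_ ?_ ?_ le_rfl hP hPd⟩
  · intro n
    rw [hy, hy]
    linarith [hsu n]
  · intro n
    rw [hy, hy]
    have hsn : (0 : ℝ) ≤ s n := Nat.cast_nonneg _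
    have h1 := mul_le_mul_of_nonneg_left (hsρ n) (sub_nonneg.mpr hdu)
    have h2 := mul_le_mul_of_nonneg_right hρu hsn
    have h3 : 0 ≤ (u * (d - 1)) * s 0 := mul_nonneg (mul_nonneg hu (by linarith)) hs0
    have h4 : 0 ≤ (d : ℝ) * s 0 := by positivity
    linarith
  · intro h
    obtain ⟨n, hn⟩ := exists_nat_gt ((h + s 0) / (ρ - (d - 1)))
    rw [div_lt_iff₀ (by linarith)] at hn
    refine ⟨n, ?_⟩
    rw [hy, hy]
    have h1 : (n : ℝ) ≤ s n := by exact_mod_cast hs.id_le n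
    have h2 := mul_le_mul_of_nonneg_right h1 (by linarith : 0 ≤ ρ - (d - 1))
    have h3 : 0 ≤ ((d : ℝ) - 1) * s 0 := mul_nonneg (by linarith) hs0
    linarith [hsρ n]

/-- The equality `s 1 = u * s 0` recurs at each multiple of the period, and subtracting `s 0` from
both degrees only helps since `1 ≤ u`. -/
theorem infinite_setOf_le_natDegree_cfDen {s : ℕ → ℕ} (hs : StrictMono s) {m Q : ℕ} {u : ℝ}
    (hm : 0 < m) (hu : 1 ≤ u) (hper : ∀ i, s (i + m) = Q * s i) (h1 : (s 1 : ℝ) = u * s 0) :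
    {k | u * (cfDen (partialQuotient F s) k).natDegree ≤
      (cfDen (partialQuotient F s) (k + 1)).natDegree}.Infinite := by
  have hmul : ∀ i j, s (i + j * m) = Q ^ j * s i := by
    intro i j
    induction j with
    | zero => simp
    | succ j ih => rw [add_mul, one_mul, ← add_assoc, hper, ih, pow_succ]; ring
  refine Set.infinite_of_injective_forall_mem (f := fun j : ℕ => j * m)
    (fun i j h => Nat.eq_of_mul_eq_mul_right hm h) fun j => ?_
  have hy : ∀ n, ((cfDen (partialQuotient F s) n).natDegree : ℝ) = s n - s 0 := fun n => by
    rw [← natDegree_cfDen_partialQuotient (F := F) hs n]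
    push_cast
    ring
  have e0 := hmul 0 j
  have e1 := hmul 1 j
  rw [zero_add] at e0
  rw [add_comm] at e1
  simp only [Set.mem_ofPred_eq, hy, e0, e1]
  push_cast
  rw [h1]
  have : 0 ≤ (u - 1) * s 0 := mul_nonneg (by linarith) (Nat.cast_nonneg _)
  linarith

/-- The threshold enters here: `u (d - 1) / (u - d) < u` amounts to `d - 1 < u - d`. -/
theorem exists_growth_ratio {d : ℕ} (hd : 1 ≤ d) {u : ℝ} (hu : 2 * (d : ℝ) - 1 < u) :
    ∃ ρ, 1 < ρ ∧ ρ < u ∧ d - 1 < ρ ∧ u * (d - 1) ≤ (u - d) * ρ := by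
  have hd1 : (1 : ℝ) ≤ d := by exact_mod_cast hd
  have hud : 0 < u - d := by linarith
  have hlt : max (max 1 ((d : ℝ) - 1)) (u * (d - 1) / (u - d)) < u := by
    refine max_lt (max_lt (by linarith) (by linarith)) ?_
    rw [div_lt_iff₀ hud]
    exact mul_lt_mul_of_pos_left (by linarith) (by linarith)
  obtain ⟨ρ, h1, h2⟩ := exists_between hlt
  rw [max_lt_iff, max_lt_iff, div_lt_iff₀ hud] at h1
  exact ⟨ρ, h1.1.1, h2, h1.1.2, by linarith [h1.2]⟩

end Construction

theorem exists_series_of_exponent (p : ℕ) [Fact p.Prime] (F : Type*) [Field F] [Finite F]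
    [CharP F p] {d : ℕ} (hd : 1 ≤ d) {u : ℚ} (hu : 2 * (d : ℝ) - 1 < u) :
    ∃ k₀ : ℕ, ∀ k ≥ k₀, 0 < k → ∃ ξ : Series F, IsClassIA p ξ ∧
      IsAlgebraicOfDegree ξ (p ^ k + 1) ∧
      ∀ n : ℕ, 1 ≤ n → n ≤ d → w n ξ = ((u : ℝ) : EReal) ∧ wStar n ξ = ((u : ℝ) : EReal) := by
  have hp : p.Prime := Fact.out
  have hd1 : (1 : ℝ) ≤ d := by exact_mod_cast hd
  obtain ⟨ρ, hρ1, hρu, hρd, hρ⟩ := exists_growth_ratio hd hu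
  obtain ⟨k₀, hk₀⟩ := Filter.eventually_atTop.mp (exists_growth_sequence hp hρ1 hρu)
  refine ⟨k₀, fun k hk hk0 => ?_⟩
  obtain ⟨l, s, hsρ, hsu, hs1, hper, hpl⟩ := hk₀ k hk
  have hs : StrictMono s := strictMono_nat_of_lt_succ fun i => by
    have h1 : (s i : ℝ) ≤ ρ * s i := le_mul_of_one_le_left (Nat.cast_nonneg _) hρ1.le
    exact_mod_cast h1.trans_lt (hsρ i)
  have ha := monic_partialQuotient (F := F) s
  have hpos := natDegree_partialQuotient_pos (F := F) hs
  obtain ⟨ξ, hξ⟩ : ∃ ξ, IsCfLimit (partialQuotient F s) ξ := exists_continuedFraction ha hpos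
  obtain ⟨c, hc, hlow⟩ := exists_lower_bound_of_growth hs hξ (by linarith) hd hρd hρ
    (fun i => (hsρ i).le) hsu
  have hne : ∀ P : F[X][X], P ≠ 0 → P.natDegree ≤ d →
      P.eval₂ (polyEmb F : F[X] →+* Series F) ξ ≠ 0 := by
    intro P hP hPd h0
    have h1 := hlow P hP hPd
    rw [h0, map_zero] at h1
    have h2 : 0 < height P := zero_lt_one.trans_le (one_le_height hP)
    exact absurd h1 (not_le.mpr (mul_pos hc (Real.rpow_pos_of_pos h2 _)))
  have hperq := partialQuotient_add (F := F) hper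
  have hinf := infinite_setOf_le_natDegree_cfDen (F := F) hs (Nat.succ_pos l)
    (by linarith) hper hs1
  refine ⟨ξ, hξ.isClassIA ha hpos hk0 hperq (not_isRational_of_lower_bound hd hne),
    hξ.isAlgebraicOfDegree ha hpos hk0 hperq ?_ (fun P hP hP1 => hne P hP (hP1.trans hd)),
    fun n hn hnd => ⟨?_, ?_⟩⟩
  -- The degree of `a l` is `s (l + 1) - s l`, where `p` divides `s (l + 1) = p ^ k * s 0` but not
  -- `s l`.
  · rw [natDegree_partialQuotient]
    intro hdvd
    have h1 : p ∣ s (l + 1) := by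
      have := hper 0
      rw [zero_add] at this
      rw [this]
      exact Dvd.dvd.mul_right (dvd_pow_self p hk0.ne') _
    have h2 : s (l + 1) - s l + s l = s (l + 1) := Nat.sub_add_cancel (hs (Nat.lt_succ_self l)).le
    rw [← h2, Nat.dvd_add_right hdvd] at h1
    exact hpl h1
  · exact le_antisymm (w_le_of_lower_bound hnd hc hlow) (hξ.le_w ha hpos hn hinf)
  · exact le_antisymm (wStar_le_of_lower_bound hnd (by linarith) hc
      (hξ.seriesAbs_lt_one hpos).le hlow) (hξ.le_wStar ha hpos hn hinf)

end LaurentExponent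

theorem mainTheorem1 (p : ℕ) [Fact p.Prime] (F : Type*) [Field F] [Finite F] [CharP F p]
    (d : ℕ) (hd : 1 ≤ d) (w : ℚ) (hw : 2 * (d : ℚ) - 1 < w) :
    ∃ (k : ℕ → ℕ) (ξ : ℕ → LaurentExponent.Series F),
      StrictMono k ∧ (∀ j, 0 < k j) ∧
      ∀ j, LaurentExponent.IsClassIA p (ξ j) ∧
        LaurentExponent.IsAlgebraicOfDegree (ξ j) (p ^ k j + 1) ∧
        ∀ n : ℕ, 1 ≤ n → n ≤ d →
          LaurentExponent.w n (ξ j) = ((w : ℝ) : EReal) ∧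
          LaurentExponent.wStar n (ξ j) = ((w : ℝ) : EReal) := by
  have hw' : 2 * (d : ℝ) - 1 < w := by exact_mod_cast hw
  obtain ⟨k₀, hk₀⟩ := LaurentExponent.exists_series_of_exponent p F hd hw'
  choose ξ hξ using fun j : ℕ => hk₀ (k₀ + 1 + j) (by omega) (by omega)
  exact ⟨fun j => k₀ + 1 + j, ξ, fun i j h => Nat.add_lt_add_left h _,
    fun _ => Nat.add_pos_left (Nat.succ_pos _) _, hξ⟩
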